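/- Let $A\ge 1$, let $\theta:[0,\infty)\to[0,\infty)$ be a homeomorphism and let $\psi:[0,\infty)\to[0,\infty)$ be an increasing function. Then there is a constant $A_1=A_1(A,\theta,\psi)\ge 1$, depending only on $A$, $\theta$ and $\psi$, with the following property. Let $E$ and $E'$ be real Banach spaces of dimension at least $2$, and let $G\subsetneq E$ and $G'\subsetneq E'$ be domains (nonempty open connected sets) such that $G$ is diameter $A$-uniform and $G'$ is $\psi$-natural. Let $f:\overline{G}\to\overline{G'}$ be a homeomorphism between the norm closures which maps $G$ onto $G'$ and is $\theta$-quasimöbius relative to $\partial G$. Then $G'$ is $A_1$-uniform. Here $d_G(x)=\operatorname{dist}(x,\partial G)$, and the notions are as follows. - $G$ is *diameter $A$-uniform* ($A\ge1$) if each pair of points $x_1,x_2\in G$ can be joined by a curve $\alpha$ in $G$ such that $\min_{j=1,2}\operatorname{diam}(\alpha[x_j,x])\le A\,d_G(x)$ for all $x\in\alpha$ and $\operatorname{diam}(\alpha)\le A|x_1-x_2|$, where $\alpha[x_j,x]$ is the part of the curve between $x_j$ and $x$. It is *$A$-uniform* if the same holds with the lengths of $\alpha[x_j,x]$ and of $\alpha$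 in place of the diameters. - $G$ is *$\psi$-natural* if $k_G(S)\le\psi(r_G(S))$ for every nonempty connected set $S\subseteq G$ with $r_G(S)<\infty$, where $r_G(S)=\sup\{|x-y|/\min\{d_G(x),d_G(y)\} : x,y\in S\}$ and $k_G(S)$ is the diameter of $S$ in the quasihyperbolic metric $k_G(x,y)=\inf_\gamma\int_\gamma |dz|/d_G(z)$, the infimum being over all rectifiable curves $\gamma$ in $G$ from $x$ to $y$. - $f$ is *$\theta$-quasimöbius relative to $\partial G$* if $\tau(f(x),f(y),f(z),f(w))\le\theta(\tau(x,y,z,w))$ for all quadruples of distinct points $x,y,z,w\in\overline{G}$ with $\{x,w\}\subseteq\partial G$ or $\{y,z\}\subseteq\partial G$, where $\tau(x,y,z,w)=\dfrac{|x-z|}{|x-y|}\cdot\dfrac{|y-w|}{|z-w|}$. -/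

import Mathlib

open scoped NNReal ENNReal

universe u v

namespace RelQM

section Domains

variable {E : Type u} [NormedAddCommGroup E]

/-- A domain that is a proper subset of `E`: open, connected, nonempty (part of `IsConnected`),
and not the whole space. -/
def IsProperDomain (G : Set E) : Prop :=
  IsOpen G ∧ IsConnected G ∧ G ≠ Set.univ

/-- The distance `d_G(x)` from `x` to the boundary of `G`. -/
noncomputable def bdist (G : Set E) (x : E) : ℝ :=
  Metric.infDist x (frontier G)

/-- `G` is diameter `A`-uniform: any two points of `G` are joined by a curve in `G` which satisfies
the diameter cigar condition and the diameter turning condition. The two subcurves cut off by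
`γ t` are the restrictions of `γ` to the parameters before and after `t`; diameters of curves are
diameters of compact sets. -/
def IsDiameterUniform (A : ℝ) (G : Set E) : Prop :=
  1 ≤ A ∧ ∀ x₁ ∈ G, ∀ x₂ ∈ G, ∃ γ : Path x₁ x₂, (∀ t, γ t ∈ G) ∧
    (∀ t, min (Metric.diam (γ '' Set.Iic t)) (Metric.diam (γ '' Set.Ici t))
      ≤ A * bdist G (γ t)) ∧
    Metric.diam (Set.range γ) ≤ A * dist x₁ x₂

/-- `G` is `A`-uniform (in the length sense): the same with lengths of curves in place of
diameters. The length of a curve is the supremum over partitions of the polygonal sums, with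
values in `[0, ∞]`. -/
def IsUniform (A : ℝ) (G : Set E) : Prop :=
  1 ≤ A ∧ ∀ x₁ ∈ G, ∀ x₂ ∈ G, ∃ γ : Path x₁ x₂, (∀ t, γ t ∈ G) ∧
    (∀ t, min (eVariationOn γ (Set.Iic t)) (eVariationOn γ (Set.Ici t))
      ≤ ENNReal.ofReal (A * bdist G (γ t))) ∧
    eVariationOn γ Set.univ ≤ ENNReal.ofReal (A * dist x₁ x₂)

/-- The quasihyperbolic distance: the infimum of the integrals of `1 / d_G` with respect to
arclength over all rectifiable curves in `G` from `x` to `y`. Each such curve is given by its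
arclength parametrization on `[0, L]`, `L` being its length. -/
noncomputable def qhDist (G : Set E) (x y : E) : ℝ≥0∞ :=
  ⨅ (L : ℝ≥0) (γ : ℝ → E) (_ : HasUnitSpeedOn γ (Set.Icc 0 (L : ℝ)))
    (_ : ∀ s ∈ Set.Icc 0 (L : ℝ), γ s ∈ G) (_ : γ 0 = x) (_ : γ L = y),
    ∫⁻ s in Set.Icc 0 (L : ℝ), (ENNReal.ofReal (bdist G (γ s)))⁻¹

/-- The quasihyperbolic diameter `k_G(S)`. -/
noncomputable def qhDiam (G S : Set E) : ℝ≥0∞ :=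
  ⨆ (x ∈ S) (y ∈ S), qhDist G x y

/-- The relative diameter `r_G(S) = sup { |x - y| / min {d_G(x), d_G(y)} : x, y ∈ S }`. -/
noncomputable def relDiam (G S : Set E) : ℝ≥0∞ :=
  ⨆ (x ∈ S) (y ∈ S), ENNReal.ofReal (dist x y / min (bdist G x) (bdist G y))

/-- `G` is `ψ`-natural: `ψ` is increasing and `k_G(S) ≤ ψ (r_G(S))` for each nonempty connected
subset `S` of `G` with `r_G(S) < ∞`. -/
def IsNatural (ψ : ℝ≥0 → ℝ≥0) (G : Set E) : Prop :=
  Monotone ψ ∧ ∀ S ⊆ G, IsConnected S → relDiam G S < ∞ →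
    qhDiam G S ≤ ψ (relDiam G S).toNNReal

end Domains

section Maps

variable {X : Type u} {Y : Type v} [MetricSpace X] [MetricSpace Y]

/-- The cross ratio `τ(x,y,z,w) = (|x - z| / |x - y|) (|y - w| / |z - w|)`. -/
noncomputable def crossRatio (x y z w : X) : ℝ≥0 :=
  nndist x z / nndist x y * (nndist y w / nndist z w)

/-- The homeomorphism `f : X → Y` is `θ`-quasimöbius relative to `S`: `τ(f(Q)) ≤ θ(τ(Q))` for each
quadruple `Q = (x,y,z,w)` of distinct points with `{x,w} ⊆ S` or `{y,z} ⊆ S`. -/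
def IsQuasimobiusRel (θ : ℝ≥0 ≃ₜ ℝ≥0) (S : Set X) (f : X ≃ₜ Y) : Prop :=
  ∀ x y z w : X, [x, y, z, w].Nodup → (x ∈ S ∧ w ∈ S) ∨ (y ∈ S ∧ z ∈ S) →
    crossRatio (f x) (f y) (f z) (f w) ≤ θ (crossRatio x y z w)

end Maps

end RelQM

/-!
The proof has two independent halves: the image domain is diameter uniform, and a natural domain
which is diameter uniform is uniform.

*Diameter uniformity of the image.* Write `x'` for `f x`. For `p, q ∈ G` and `a, b ∈ ∂G` the
hypothesis controls the cross ratio `|a - q| |b - p| / (|a - p| |b - q|)`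
(`IsQuasimobiusRel.mul_dist_le`). Let `α` be a diameter cigar from `x₁` to `x₂`. If its image
violates the turning or the cigar condition, there are points on it at which the violation is, by
continuity, of a prescribed moderate order. If moreover the boundary of `G'` is large on the scale
considered, it contains a point `c'` so remote that the factors containing `c'` nearly cancel in
cross ratios, and the violation makes two cross ratios large simultaneously, where `a'` is a
boundary point almost nearest to `x₁'` or to the point at which the cigar condition fails. The
cross ratios of the preimages are then both large, which the geometry of `α` forbids
(`not_crossRatio_large_of_turning`, `not_crossRatio_large_of_cigar`). This gives
`IsCigarRel.dist_image_le` and `IsCigarRel.dist_image_le_or`.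

If the boundary of `G'` is unbounded, nothing else is needed. If it is bounded, of diameter `D`,
then at scales above `D` the conditions hold trivially for curves in a ball of radius `3 D`, and the
image of `α` is pushed into this ball by the radial retraction (`DiamJoined.image_of_near`). The
retraction maps `G'` into itself, since `G'` lies in the concentric ball of radius `D` or contains
its complement (`IsProperDomain.subset_closedBall_or`). Points outside the larger ball are treated
by hand, with curves on spheres and radial segments (`DiamJoined.of_far`,
`DiamJoined.of_radialRetraction`). This also covers the case of a single boundary point, in which
the hypothesis on cross ratios is void. The behaviour of `f` near infinity plays no role.

*From diameters to lengths.* A diameter cigar is divided where the diameters of the two parts are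
equal, and each half is cut at its exits from balls of radii `2 ^ n * d` about its end point.
Every piece has bounded relative diameter, so naturality replaces it by a curve of bounded
quasihyperbolic length. Such a curve is short in comparison with its distance to the boundary, and
the lengths add up to a geometric sum (`IsNatural.carrotJoined_of_le`, `DiamJoined.lengthJoined`).
Two points that are close in comparison with their distance to the boundary are joined by a segment.
-/

namespace RelQM

/-! ### Distance to the boundary -/

section Boundary

variable {E : Type u} [NormedAddCommGroup E]

lemma bdist_le_add (G : Set E) (x y : E) : bdist G x ≤ bdist G y + dist x y :=
  Metric.infDist_le_infDist_add_dist

lemma bdist_le_dist {G : Set E} (x : E) {a : E} (ha : a ∈ frontier G) : bdist G x ≤ dist x a :=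
  Metric.infDist_le_dist_of_mem ha

/-- A connected set that meets the open set `G` but not its boundary lies in `G`. -/
lemma subset_of_disjoint_frontier {G K : Set E} (hG : IsOpen G) (hK : IsPreconnected K)
    (hd : ∀ x ∈ K, x ∉ frontier G) {p : E} (hpK : p ∈ K) (hpG : p ∈ G) : K ⊆ G := by
  refine hK.subset_left_of_subset_union hG (isClosed_closure (s := G)).isOpen_compl
    (Set.disjoint_compl_right_iff_subset.2 subset_closure) (fun x hx => ?_) ⟨p, hpK, hpG⟩
  by_cases hxc : x ∈ closure G
  · left
    by_contra hxG
    exact hd x hx ⟨hxc, by rwa [hG.interior_eq]⟩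
  · exact Or.inr hxc

variable [NormedSpace ℝ E]

lemma IsProperDomain.frontier_nonempty {G : Set E} (hG : IsProperDomain G) :
    (frontier G).Nonempty :=
  nonempty_frontier_iff.2 ⟨hG.2.1.nonempty, hG.2.2⟩

lemma IsProperDomain.bdist_pos {G : Set E} (hG : IsProperDomain G) {x : E} (hx : x ∈ G) :
    0 < bdist G x :=
  (isClosed_frontier.notMem_iff_infDist_pos hG.frontier_nonempty).1
    fun h => h.2 (by rwa [hG.1.interior_eq])

lemma IsProperDomain.exists_frontier_lt {G : Set E} (hG : IsProperDomain G) {x : E} (hx : x ∈ G) :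
    ∃ a ∈ frontier G, dist x a < 2 * bdist G x := by
  have h := hG.bdist_pos hx
  exact (Metric.infDist_lt_iff hG.frontier_nonempty).1 (show bdist G x < 2 * bdist G x by linarith)

lemma IsProperDomain.ball_subset {G : Set E} (hG : IsProperDomain G) {x : E} (hx : x ∈ G) :
    Metric.ball x (bdist G x) ⊆ G := by
  refine subset_of_disjoint_frontier hG.1 (convex_ball x _).isPreconnected (fun y hy hyf => ?_)
    (Metric.mem_ball_self (hG.bdist_pos hx)) hx
  have := bdist_le_dist x hyf
  rw [Metric.mem_ball, dist_comm] at hy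
  linarith

end Boundary

/-! ### Quasihyperbolically short curves -/

section Quasihyperbolic

variable {E : Type u} [NormedAddCommGroup E]

lemma lintegral_inv_add {d L : ℝ} (hd : 0 < d) (hL : 0 ≤ L) :
    ∫⁻ s in Set.Icc 0 L, (ENNReal.ofReal (d + s))⁻¹ = ENNReal.ofReal (Real.log ((d + L) / d)) := by
  have hcont : ContinuousOn (fun s : ℝ => (d + s)⁻¹) (Set.Icc 0 L) :=
    ContinuousOn.inv₀ (by fun_prop) fun s hs => by have := hs.1; positivity
  have h1 : ∫ s in Set.Icc 0 L, (d + s)⁻¹ = Real.log ((d + L) / d) := by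
    rw [MeasureTheory.integral_Icc_eq_integral_Ioc, ← intervalIntegral.integral_of_le hL,
      intervalIntegral.integral_comp_add_left (fun s => s⁻¹) d, add_zero,
      integral_inv_of_pos hd (by linarith)]
  rw [← h1, MeasureTheory.ofReal_integral_eq_lintegral_ofReal
    (hcont.integrableOn_compact isCompact_Icc)]
  · refine MeasureTheory.setLIntegral_congr_fun measurableSet_Icc fun s hs => ?_
    exact (ENNReal.ofReal_inv_of_pos (by have := hs.1; linarith)).symm
  · refine (MeasureTheory.ae_restrict_iff' measurableSet_Icc).2 (Filter.Eventually.of_forall ?_)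
    intro s hs
    have := hs.1
    show 0 ≤ (d + s)⁻¹
    positivity

lemma lintegral_inv_sub {d L : ℝ} (hd : 0 < d) (hL : 0 ≤ L) :
    ∫⁻ s in Set.Icc 0 L, (ENNReal.ofReal (d + (L - s)))⁻¹ =
      ENNReal.ofReal (Real.log ((d + L) / d)) := by
  have hcont : ContinuousOn (fun s : ℝ => (d + (L - s))⁻¹) (Set.Icc 0 L) :=
    ContinuousOn.inv₀ (by fun_prop) fun s hs => by have := hs.2; linarith
  have h1 : ∫ s in Set.Icc 0 L, (d + (L - s))⁻¹ = Real.log ((d + L) / d) := by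
    rw [MeasureTheory.integral_Icc_eq_integral_Ioc, ← intervalIntegral.integral_of_le hL,
      intervalIntegral.integral_comp_sub_left (fun s => (d + s)⁻¹) L,
      intervalIntegral.integral_comp_add_left (fun s => s⁻¹) d, sub_self, sub_zero, add_zero,
      integral_inv_of_pos hd (by linarith)]
  rw [← h1, MeasureTheory.ofReal_integral_eq_lintegral_ofReal
    (hcont.integrableOn_compact isCompact_Icc)]
  · refine MeasureTheory.setLIntegral_congr_fun measurableSet_Icc fun s hs => ?_
    exact (ENNReal.ofReal_inv_of_pos (by have := hs.2; linarith)).symm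
  · refine (MeasureTheory.ae_restrict_iff' measurableSet_Icc).2 (Filter.Eventually.of_forall ?_)
    intro s hs
    have := hs.2
    show 0 ≤ (d + (L - s))⁻¹
    have : 0 ≤ d + (L - s) := by linarith
    positivity

lemma add_le_exp_mul_of_log_le {d L N : ℝ} (hd : 0 < d) (hL : 0 ≤ L) (hN : 0 ≤ N)
    (h : ENNReal.ofReal (Real.log ((d + L) / d)) ≤ ENNReal.ofReal N) :
    d + L ≤ Real.exp N * d := by
  rw [ENNReal.ofReal_le_ofReal_iff hN, Real.log_le_iff_le_exp (by positivity),
    div_le_iff₀ hd] at h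
  exact h

/-- Points at quasihyperbolic distance at most `M` are joined by a curve, with parameter bounding
its length, whose length is at most a multiple of the distance of its initial point to the
boundary, and along which that distance stays bounded below. The curve is extended to `ℝ` so as to
be `1`-Lipschitz everywhere. -/
lemma exists_lipschitz_of_qhDist_le {G : Set E} {x y : E} {M : ℝ} (hM : 0 ≤ M)
    (hpos : ∀ z ∈ G, 0 < bdist G z) (hq : qhDist G x y ≤ ENNReal.ofReal M) :
    ∃ (g : ℝ → E) (T : ℝ), LipschitzWith 1 g ∧ 0 ≤ T ∧ g 0 = x ∧ g T = y ∧
      T ≤ Real.exp (M + 1) * bdist G x ∧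
      ∀ s ∈ Set.Icc 0 T, g s ∈ G ∧ bdist G x ≤ Real.exp (M + 1) * bdist G (g s) := by
  have hlt : qhDist G x y < ENNReal.ofReal (M + 1) :=
    hq.trans_lt ((ENNReal.ofReal_lt_ofReal_iff (by linarith)).2 (by linarith))
  simp only [qhDist, iInf_lt_iff] at hlt
  obtain ⟨L, γ, hγ, hG, h0, h1, hint⟩ := hlt
  have hL : (0 : ℝ) ≤ L := L.2
  have hLip : LipschitzOnWith 1 γ (Set.Icc 0 (L : ℝ)) := by
    have key : ∀ s ∈ Set.Icc 0 (L : ℝ), ∀ t ∈ Set.Icc 0 (L : ℝ), s ≤ t →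
        edist (γ s) (γ t) ≤ 1 * edist s t := by
      intro s hs t ht hst
      have h := hγ hs ht
      have h2 := eVariationOn.edist_le γ (s := Set.Icc 0 (L : ℝ) ∩ Set.Icc s t)
        ⟨hs, le_refl _, hst⟩ ⟨ht, hst, le_refl _⟩
      rw [h] at h2
      rw [one_mul, edist_dist s t, dist_comm, Real.dist_eq, abs_of_nonneg (by linarith)]
      simpa using h2
    intro s hs t ht
    rcases le_total s t with h | h
    · exact key s hs t ht h
    · rw [edist_comm, edist_comm s]
      exact key t ht s hs h
  have hpr : ∀ s ∈ Set.Icc 0 (L : ℝ), ((Set.projIcc 0 (L : ℝ) hL s : Set.Icc 0 (L : ℝ)) : ℝ) = s :=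
    fun s hs => by rw [Set.projIcc_of_mem hL hs]
  have hdist : ∀ s ∈ Set.Icc 0 (L : ℝ), ∀ t ∈ Set.Icc 0 (L : ℝ),
      dist (γ s) (γ t) ≤ |s - t| := by
    intro s hs t ht
    simpa [Real.dist_eq] using hLip.dist_le_mul s hs t ht
  have h00 : (0 : ℝ) ∈ Set.Icc 0 (L : ℝ) := ⟨le_refl _, hL⟩
  have hxG : x ∈ G := h0 ▸ hG 0 h00
  refine ⟨fun s => γ (Set.projIcc 0 (L : ℝ) hL s), L, ?_, hL, ?_, ?_, ?_, ?_⟩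
  · have := (hLip.to_restrict).comp (LipschitzWith.projIcc hL)
    rwa [mul_one] at this
  · simp only [hpr 0 h00, h0]
  · simp only [hpr L ⟨hL, le_refl _⟩, h1]
  · have h5 : bdist G x + L ≤ Real.exp (M + 1) * bdist G x := by
      refine add_le_exp_mul_of_log_le (hpos x hxG) hL (by linarith) ?_
      rw [← lintegral_inv_add (hpos x hxG) hL]
      refine le_trans (MeasureTheory.setLIntegral_mono' measurableSet_Icc fun s hs => ?_) hint.le
      refine ENNReal.inv_le_inv.2 (ENNReal.ofReal_le_ofReal ?_)
      have h2 := hdist s hs 0 h00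
      rw [sub_zero, abs_of_nonneg hs.1, h0] at h2
      linarith [bdist_le_add G (γ s) x]
    linarith [hpos x hxG]
  · intro s hs
    simp only [hpr s hs]
    refine ⟨hG s hs, ?_⟩
    have hp := hpos _ (hG s hs)
    have h3 : bdist G (γ s) + s ≤ Real.exp (M + 1) * bdist G (γ s) := by
      refine add_le_exp_mul_of_log_le hp hs.1 (by linarith) ?_
      rw [← lintegral_inv_sub hp hs.1]
      refine le_trans ?_ ((MeasureTheory.lintegral_mono_set
        (Set.Icc_subset_Icc_right hs.2)).trans hint.le)
      refine MeasureTheory.setLIntegral_mono' measurableSet_Icc fun r hr => ?_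
      refine ENNReal.inv_le_inv.2 (ENNReal.ofReal_le_ofReal ?_)
      have h2 := hdist r ⟨hr.1, hr.2.trans hs.2⟩ s hs
      rw [abs_sub_comm, abs_of_nonneg (by linarith [hr.2])] at h2
      linarith [bdist_le_add G (γ r) (γ s)]
    have h4 := hdist s hs 0 h00
    rw [sub_zero, abs_of_nonneg hs.1, h0, dist_comm] at h4
    linarith [bdist_le_add G x (γ s)]

end Quasihyperbolic

/-! ### Curves with a length parameter -/

section LengthCurves

variable {E : Type u} [NormedAddCommGroup E]

/-- The condition imposed on a pair of points in the definition of an `A`-uniform domain. -/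
def LengthJoined (A : ℝ) (G : Set E) (x₁ x₂ : E) : Prop :=
  ∃ γ : Path x₁ x₂, (∀ t, γ t ∈ G) ∧
    (∀ t, min (eVariationOn γ (Set.Iic t)) (eVariationOn γ (Set.Ici t))
      ≤ ENNReal.ofReal (A * bdist G (γ t))) ∧
    eVariationOn γ Set.univ ≤ ENNReal.ofReal (A * dist x₁ x₂)

/-- The condition imposed on a pair of points in the definition of a diameter `A`-uniform
domain. -/
def DiamJoined (A : ℝ) (G : Set E) (x₁ x₂ : E) : Prop :=
  ∃ γ : Path x₁ x₂, (∀ t, γ t ∈ G) ∧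
    (∀ t, min (Metric.diam (γ '' Set.Iic t)) (Metric.diam (γ '' Set.Ici t))
      ≤ A * bdist G (γ t)) ∧
    Metric.diam (Set.range γ) ≤ A * dist x₁ x₂

/-- `x` is joined to `y` by a length `c`-carrot with vertex `x`: a curve in `G`, parametrized on
`[0, T]` with speed at most `1`, whose subcurve from `x` to any of its points is short in
comparison with the distance of this point to the boundary. -/
def CarrotJoined (c : ℝ) (G : Set E) (x y : E) (T : ℝ) : Prop :=
  0 ≤ T ∧ ∃ g : ℝ → E, LipschitzWith 1 g ∧ g 0 = x ∧ g T = y ∧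
    ∀ s ∈ Set.Icc 0 T, g s ∈ G ∧ s ≤ c * bdist G (g s)

lemma eVariationOn_comp_mul_le {g : ℝ → E} (hg : LipschitzWith 1 g) {T : ℝ} (hT : 0 ≤ T)
    {S : Set unitInterval} {a b : unitInterval} (ha : a ∈ S) (hb : b ∈ S) (hS : S ⊆ Set.Icc a b) :
    eVariationOn (fun t : unitInterval => g (T * t)) S ≤ ENNReal.ofReal (T * b - T * a) := by
  have hm : MonotoneOn (fun t : unitInterval => T * (t : ℝ)) S := fun s _ t _ hst =>
    mul_le_mul_of_nonneg_left hst hT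
  have h1 := (hm.eVariationOn_eq ha hb).le
  rw [Set.inter_eq_left.2 hS] at h1
  have h2 := (hg.lipschitzOnWith (s := Set.univ)).comp_eVariationOn_le
    (g := fun t : unitInterval => T * (t : ℝ)) (s := S) (Set.mapsTo_univ _ _)
  rw [ENNReal.coe_one, one_mul] at h2
  exact h2.trans h1

lemma LengthJoined.of_lipschitz {A c : ℝ} {G : Set E} {x y : E} {g : ℝ → E} {T : ℝ}
    (hg : LipschitzWith 1 g) (hT : 0 ≤ T) (h0 : g 0 = x) (h1 : g T = y)
    (hG : ∀ s ∈ Set.Icc 0 T, g s ∈ G)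
    (hc : ∀ s ∈ Set.Icc 0 T, min s (T - s) ≤ c * bdist G (g s)) (hcA : c ≤ A)
    (hTA : T ≤ A * dist x y) : LengthJoined A G x y := by
  have hmem : ∀ t : unitInterval, T * (t : ℝ) ∈ Set.Icc 0 T := fun t =>
    ⟨mul_nonneg hT t.2.1, mul_le_of_le_one_right hT t.2.2⟩
  refine ⟨⟨⟨fun t => g (T * t), by have := hg.continuous; fun_prop⟩, by simpa, by simpa⟩,
    fun t => hG _ (hmem t), fun t => ?_, ?_⟩
  · show min (eVariationOn (fun t : unitInterval => g (T * t)) (Set.Iic t))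
      (eVariationOn (fun t : unitInterval => g (T * t)) (Set.Ici t)) ≤
        ENNReal.ofReal (A * bdist G (g (T * t)))
    have hle := (hc _ (hmem t)).trans
      (mul_le_mul_of_nonneg_right hcA (Metric.infDist_nonneg : 0 ≤ bdist G (g (T * t))))
    rcases min_le_iff.1 hle with h | h
    · refine (min_le_left _ _).trans ((eVariationOn_comp_mul_le hg hT (a := 0) (b := t) ?_ ?_ ?_).trans
        (ENNReal.ofReal_le_ofReal ?_))
      · exact t.2.1
      · exact le_refl t
      · exact fun s hs => ⟨s.2.1, hs⟩
      · simpa using h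
    · refine (min_le_right _ _).trans ((eVariationOn_comp_mul_le hg hT (a := t) (b := 1) ?_ ?_ ?_).trans
        (ENNReal.ofReal_le_ofReal ?_))
      · exact le_refl t
      · exact t.2.2
      · exact fun s hs => ⟨hs, s.2.2⟩
      · simpa using h
  · show eVariationOn (fun t : unitInterval => g (T * t)) Set.univ ≤ _
    refine (eVariationOn_comp_mul_le hg hT (a := 0) (b := 1) (Set.mem_univ _) (Set.mem_univ _)
      fun s _ => ⟨s.2.1, s.2.2⟩).trans (ENNReal.ofReal_le_ofReal ?_)
    simpa using hTA

lemma exists_lipschitz_concat {g₁ g₂ : ℝ → E} (h₁ : LipschitzWith 1 g₁) (h₂ : LipschitzWith 1 g₂)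
    {T : ℝ} (h : g₁ T = g₂ 0) :
    ∃ g : ℝ → E, LipschitzWith 1 g ∧ (∀ s ≤ T, g s = g₁ s) ∧ ∀ s, T ≤ s → g s = g₂ (s - T) := by
  refine ⟨fun s => g₁ (min s T) + (g₂ (max (s - T) 0) - g₂ 0), ?_, fun s hs => ?_, fun s hs => ?_⟩
  · refine LipschitzWith.of_dist_le_mul fun s t => ?_
    have e1 := h₁.dist_le_mul (min s T) (min t T)
    have e2 := h₂.dist_le_mul (max (s - T) 0) (max (t - T) 0)
    rw [NNReal.coe_one, one_mul, Real.dist_eq] at *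
    refine (dist_add_add_le _ _ _ _).trans ?_
    rw [dist_sub_right]
    refine (add_le_add e1 e2).trans ?_
    -- the two coordinates of `s ↦ (min s T, max (s - T) 0)` increase with total speed `1`
    rcases le_total s T with a | a <;> rcases le_total t T with b | b <;>
      simp only [min_eq_left, min_eq_right, max_eq_left, max_eq_right, a, b, sub_nonneg,
        sub_nonpos, sub_self, sub_zero, abs_zero, add_zero, zero_add, zero_sub, abs_neg]
    · exact le_refl _
    · rw [abs_of_nonpos (by linarith), abs_of_nonneg (by linarith), abs_of_nonpos (by linarith)]
      linarith
    · rw [abs_of_nonneg (by linarith), abs_of_nonneg (by linarith), abs_of_nonneg (by linarith)]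
      linarith
    · rw [sub_sub_sub_cancel_right]
  · simp [min_eq_left hs, max_eq_right (sub_nonpos.2 hs)]
  · simp [min_eq_right hs, max_eq_left (sub_nonneg.2 hs), h]

lemma CarrotJoined.append {c : ℝ} {G : Set E} {x y z : E} {T T' : ℝ} (h : CarrotJoined c G x y T)
    {g' : ℝ → E} (hg' : LipschitzWith 1 g') (hT' : 0 ≤ T') (h0 : g' 0 = y) (h1 : g' T' = z)
    (hc : ∀ s ∈ Set.Icc 0 T', g' s ∈ G ∧ T + s ≤ c * bdist G (g' s)) :
    CarrotJoined c G x z (T + T') := by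
  obtain ⟨hT, g₁, hg₁, e0, e1, hcar⟩ := h
  obtain ⟨g, hg, ha, hb⟩ := exists_lipschitz_concat hg₁ hg' (e1.trans h0.symm)
  refine ⟨by linarith, g, hg, (ha 0 hT).trans e0, ?_, fun s hs => ?_⟩
  · rw [hb _ (by linarith), add_sub_cancel_left, h1]
  · rcases le_total s T with h | h
    · rw [ha s h]
      exact hcar s ⟨hs.1, h⟩
    · rw [hb s h]
      have := hc (s - T) ⟨by linarith, by linarith [hs.2]⟩
      rwa [add_sub_cancel] at this

/-- Two carrots with a common end point form a cigar. -/
lemma LengthJoined.of_carrots {A c : ℝ} {G : Set E} {x y m : E} {T T' : ℝ}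
    (h : CarrotJoined c G x m T) (h' : CarrotJoined c G y m T') (hcA : c ≤ A)
    (hTA : T + T' ≤ A * dist x y) : LengthJoined A G x y := by
  obtain ⟨hT, g₁, hg₁, e0, e1, hcar⟩ := h
  obtain ⟨hT', g₂, hg₂, e0', e1', hcar'⟩ := h'
  have hrev : LipschitzWith 1 fun s : ℝ => g₂ (T' - s) := by
    refine LipschitzWith.of_dist_le_mul fun s t => ?_
    have := hg₂.dist_le_mul (T' - s) (T' - t)
    rwa [dist_sub_left] at this
  obtain ⟨g, hg, ha, hb⟩ := exists_lipschitz_concat hg₁ hrev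
    (T := T) (by simp only [sub_zero, e1, e1'])
  have hG : ∀ s ∈ Set.Icc 0 (T + T'), g s ∈ G ∧ min s (T + T' - s) ≤ c * bdist G (g s) := by
    intro s hs
    rcases le_total s T with h | h
    · rw [ha s h]
      exact ⟨(hcar s ⟨hs.1, h⟩).1, (min_le_left _ _).trans (hcar s ⟨hs.1, h⟩).2⟩
    · rw [hb s h]
      have := hcar' (T' - (s - T)) ⟨by linarith [hs.2], by linarith⟩
      exact ⟨this.1, (min_le_right _ _).trans (by linarith [this.2])⟩
  refine LengthJoined.of_lipschitz hg (add_nonneg hT hT') ((ha 0 hT).trans e0) ?_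
    (fun s hs => (hG s hs).1) (fun s hs => (hG s hs).2) hcA hTA
  rw [hb _ (by linarith), add_sub_cancel_left, sub_self, e0']

variable [NormedSpace ℝ E]

/-- Points that are close in comparison with their distance to the boundary are joined by a
segment. -/
lemma LengthJoined.of_dist_le {A : ℝ} (hA : 1 ≤ A) {G : Set E} (hG : IsProperDomain G) {x y : E}
    (hx : x ∈ G) (hy : y ∈ G) (h : dist x y ≤ max (bdist G x) (bdist G y) / 2) :
    LengthJoined A G x y := by
  set T := dist x y with hTdef
  have hT : 0 ≤ T := dist_nonneg
  set g : ℝ → E := fun s => x + (s / T) • (y - x) with hgdef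
  have hdist : ∀ s t : ℝ, dist (g s) (g t) ≤ |s - t| := by
    intro s t
    rw [hgdef]
    simp only [dist_add_left]
    rw [dist_eq_norm, ← sub_smul, norm_smul, ← sub_div, norm_div, Real.norm_eq_abs, Real.norm_eq_abs, abs_of_nonneg hT,
      show ‖y - x‖ = T by rw [hTdef, dist_comm, dist_eq_norm]]
    rcases hT.eq_or_lt with e | e
    · rw [← e, mul_zero]
      exact abs_nonneg _
    · rw [div_mul_cancel₀ _ e.ne']
  have h0 : g 0 = x := by simp [hgdef]
  have h1 : g T = y := by
    rcases hT.eq_or_lt with e | e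
    · have : x = y := dist_eq_zero.1 e.symm
      simp [hgdef, this]
    · simp [hgdef, div_self e.ne']
  have key : ∀ s ∈ Set.Icc 0 T, g s ∈ G ∧ T ≤ bdist G (g s) := by
    intro s hs
    have d0 := hdist s 0
    have d1 := hdist s T
    rw [h0, sub_zero, abs_of_nonneg hs.1] at d0
    rw [h1, abs_of_nonpos (by linarith [hs.2])] at d1
    have p0 := hG.bdist_pos hx
    have p1 := hG.bdist_pos hy
    have hs1 := hs.1
    have hs2 := hs.2
    rcases le_total (bdist G x) (bdist G y) with e | e
    · rw [max_eq_right e] at h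
      refine ⟨hG.ball_subset hy (Metric.mem_ball.2 (by linarith)), ?_⟩
      have := bdist_le_add G y (g s)
      rw [dist_comm] at this
      linarith
    · rw [max_eq_left e] at h
      refine ⟨hG.ball_subset hx (Metric.mem_ball.2 (by linarith)), ?_⟩
      have := bdist_le_add G x (g s)
      rw [dist_comm] at this
      linarith
  refine LengthJoined.of_lipschitz (c := 1) (LipschitzWith.of_dist_le_mul fun s t => ?_) hT h0 h1
    (fun s hs => (key s hs).1) (fun s hs => ?_) hA ?_
  · simpa [Real.dist_eq] using hdist s t
  · rw [one_mul]
    exact ((min_le_left _ _).trans hs.2).trans (key s hs).2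
  · exact le_mul_of_one_le_left hT hA

end LengthCurves

/-! ### From diameters to lengths in natural domains -/

/-- A continuous function on `[0, 1]` starting at or below the level `r` and exceeding it later
reaches `r` at a first exit time. -/
lemma exists_first_exit {φ : unitInterval → ℝ} (hφ : Continuous φ) {r : ℝ} (h0 : φ 0 ≤ r)
    {u : unitInterval} (hu : r < φ u) : ∃ s ≤ u, φ s = r ∧ ∀ t ≤ s, φ t ≤ r := by
  have hcomp : IsCompact {s : unitInterval | r ≤ φ s} :=
    (isClosed_le continuous_const hφ).isCompact
  obtain ⟨s, hs, hmin⟩ := hcomp.exists_isLeast ⟨u, hu.le⟩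
  have hs' : r ≤ φ s := hs
  obtain ⟨t, ht, hteq⟩ := intermediate_value_Icc (show (0 : unitInterval) ≤ s from s.2.1)
    hφ.continuousOn ⟨h0, hs'⟩
  have hst : s = t := le_antisymm (hmin hteq.ge) ht.2
  refine ⟨s, hmin hu.le, hst ▸ hteq, fun t ht => ?_⟩
  by_contra hlt
  push Not at hlt
  have := le_antisymm ht (hmin hlt.le)
  rw [this, hst, hteq] at hlt
  exact lt_irrefl _ hlt

section Natural

variable {E : Type u} [NormedAddCommGroup E]

/-- On a subcurve of relative size at most `r`, a natural domain has a quasihyperbolically short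
curve between the end points. -/
lemma IsNatural.exists_lipschitz {ψ : ℝ≥0 → ℝ≥0} {G : Set E} (hψ : IsNatural ψ G)
    (hpos : ∀ z ∈ G, 0 < bdist G z) {x y : E} (γ : Path x y) (hγ : ∀ t, γ t ∈ G)
    {s t : unitInterval} (hst : s ≤ t) {z : E} {r ρ d : ℝ} (hd : 0 < d) (hr : 2 * ρ ≤ r * d)
    (hρ : ∀ v ∈ Set.Icc s t, dist (γ v) z ≤ ρ) (hdv : ∀ v ∈ Set.Icc s t, d ≤ bdist G (γ v)) :
    ∃ (g : ℝ → E) (T : ℝ), LipschitzWith 1 g ∧ 0 ≤ T ∧ g 0 = γ s ∧ g T = γ t ∧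
      T ≤ Real.exp (ψ r.toNNReal + 1) * bdist G (γ s) ∧
      ∀ v ∈ Set.Icc 0 T, g v ∈ G ∧
        bdist G (γ s) ≤ Real.exp (ψ r.toNNReal + 1) * bdist G (g v) := by
  have hsmem : s ∈ Set.Icc s t := ⟨le_refl _, hst⟩
  have htmem : t ∈ Set.Icc s t := ⟨hst, le_refl _⟩
  have hrel : relDiam G (γ '' Set.Icc s t) ≤ ENNReal.ofReal r := by
    refine iSup₂_le fun p hp => iSup₂_le fun q hq => ENNReal.ofReal_le_ofReal ?_
    obtain ⟨a, ha, rfl⟩ := hp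
    obtain ⟨b, hb, rfl⟩ := hq
    have hmin : d ≤ min (bdist G (γ a)) (bdist G (γ b)) := le_min (hdv a ha) (hdv b hb)
    rw [div_le_iff₀ (hd.trans_le hmin)]
    have h1 := hρ a ha
    have h2 := hρ b hb
    have h3 := dist_triangle_right (γ a) (γ b) z
    have h0 : 0 ≤ ρ := dist_nonneg.trans h1
    have hr0 : 0 ≤ r := by
      by_contra hneg
      push Not at hneg
      nlinarith
    nlinarith
  have hconn : IsConnected (γ '' Set.Icc s t) :=
    ⟨⟨_, s, hsmem, rfl⟩, isPreconnected_Icc.image _ γ.continuous.continuousOn⟩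
  have hk := hψ.2 _ (by rintro _ ⟨v, -, rfl⟩; exact hγ v) hconn
    (hrel.trans_lt ENNReal.ofReal_lt_top)
  have hmono : ψ (relDiam G (γ '' Set.Icc s t)).toNNReal ≤ ψ r.toNNReal :=
    hψ.1 (ENNReal.toNNReal_mono ENNReal.ofReal_ne_top hrel)
  refine exists_lipschitz_of_qhDist_le (ψ r.toNNReal).2 hpos ?_
  calc qhDist G (γ s) (γ t) ≤ qhDiam G (γ '' Set.Icc s t) :=
        le_iSup₂_of_le (γ s) ⟨s, hsmem, rfl⟩ (le_iSup₂_of_le (γ t) ⟨t, htmem, rfl⟩ (le_refl _))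
    _ ≤ ψ (relDiam G (γ '' Set.Icc s t)).toNNReal := hk
    _ ≤ ENNReal.ofReal (ψ r.toNNReal) := by
        rw [ENNReal.ofReal_coe_nnreal]
        exact ENNReal.coe_le_coe.2 hmono

/-- The bound `exp (M + 1)`, where `M` is the quasihyperbolic diameter that a `ψ`-natural domain
allows for sets of relative diameter `4 A`. -/
noncomputable def naturalBound (A : ℝ) (ψ : ℝ≥0 → ℝ≥0) : ℝ :=
  Real.exp (ψ (4 * A).toNNReal + 1)

lemma one_le_naturalBound (A : ℝ) (ψ : ℝ≥0 → ℝ≥0) : 1 ≤ naturalBound A ψ :=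
  Real.one_le_exp (by positivity)

/-- A diameter carrot yields a length carrot: the diameter carrot is cut at its exits from the
balls of radii `2 ^ n * d / 2` about the vertex, `d` being the distance of the vertex to the
boundary, and each piece is replaced by a quasihyperbolically short curve. The lengths of these
curves are dominated by a geometric progression. -/
lemma IsNatural.carrotJoined_of_le {A : ℝ} (hA : 1 ≤ A) {ψ : ℝ≥0 → ℝ≥0} {G : Set E}
    (hψ : IsNatural ψ G) (hpos : ∀ z ∈ G, 0 < bdist G z) {x y : E} (γ : Path x y)
    (hγ : ∀ t, γ t ∈ G) {t₀ : unitInterval}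
    (hcar : ∀ t ≤ t₀, ∀ s ≤ t, dist (γ s) x ≤ A * bdist G (γ t)) (n : ℕ) :
    ∀ t ≤ t₀, (∀ s ≤ t, dist (γ s) x ≤ 2 ^ n * bdist G x / 2) →
      ∃ T ≤ 2 * naturalBound A ψ * (2 ^ n * bdist G x),
        CarrotJoined (8 * A * naturalBound A ψ ^ 2) G x (γ t) T := by
  set B := naturalBound A ψ with hB
  have hB1 : 1 ≤ B := one_le_naturalBound A ψ
  have hδ : 0 < bdist G x := by simpa using hpos _ (hγ 0)
  set δ := bdist G x with hδdef
  induction n with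
  | zero =>
    intro t _ hball
    obtain ⟨g, T, hg, hT, h0, h1, hTle, hgG⟩ := hψ.exists_lipschitz hpos γ hγ
      (show (0 : unitInterval) ≤ t from t.2.1) (z := x) (r := 4 * A) (ρ := δ / 2) (d := δ / 2)
      (by linarith) (by nlinarith)
      (fun v hv => by simpa using hball v hv.2)
      (fun v hv => by
        have h1 := hball v hv.2
        have h2 := bdist_le_add G x (γ v)
        rw [dist_comm] at h2
        rw [pow_zero, one_mul] at h1
        linarith)
    rw [γ.source] at h0 hTle hgG
    change T ≤ B * δ at hTle
    change ∀ v ∈ Set.Icc 0 T, g v ∈ G ∧ δ ≤ B * bdist G (g v) at hgG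
    have hBδ : 0 < B * δ := by positivity
    refine ⟨T, by rw [pow_zero, one_mul]; linarith, hT, g, hg, h0, h1, fun s hs => ⟨(hgG s hs).1, ?_⟩⟩
    have hb := (hgG s hs).2
    calc s ≤ B * δ := hs.2.trans hTle
      _ ≤ B * (B * bdist G (g s)) := by gcongr
      _ = 1 * (B ^ 2 * bdist G (g s)) := by ring
      _ ≤ (8 * A) * (B ^ 2 * bdist G (g s)) := by
          have := hpos _ (hgG s hs).1
          gcongr
          linarith
      _ = 8 * A * B ^ 2 * bdist G (g s) := by ring
  | succ n ih =>
    intro t ht hball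
    set R := 2 ^ n * δ with hR
    have hRδ : δ ≤ R := le_mul_of_one_le_left hδ.le (one_le_pow₀ (by norm_num))
    have hpow : 2 ^ (n + 1) * δ = 2 * R := by rw [pow_succ, hR]; ring
    rw [hpow] at hball ⊢
    have hBR : 0 < B * R := by have := hδ.trans_le hRδ; positivity
    by_cases hsmall : ∀ s ≤ t, dist (γ s) x ≤ R / 2
    · obtain ⟨T, hT, hc⟩ := ih t ht hsmall
      exact ⟨T, by linarith, hc⟩
    push Not at hsmall
    obtain ⟨u, hut, hu⟩ := hsmall
    obtain ⟨s, hsu, hs, hbefore⟩ := exists_first_exit (φ := fun v => dist (γ v) x)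
      (by fun_prop) (r := R / 2) (by simp only [γ.source, dist_self]; linarith) hu
    have hst := hsu.trans hut
    obtain ⟨T, hT, hc⟩ := ih s (hst.trans ht) hbefore
    obtain ⟨g, T', hg, hT', h0, h1, hTle, hgG⟩ := hψ.exists_lipschitz hpos γ hγ hst
      (z := x) (r := 4 * A) (ρ := R) (d := R / (2 * A)) (by have := hδ.trans_le hRδ; positivity)
      (by rw [mul_div_assoc', le_div_iff₀ (by positivity)]; linarith)
      (fun v hv => by have := hball v hv.2; linarith)
      (fun v hv => by
        have h1 := hcar v (hv.2.trans ht) s hv.1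
        rw [div_le_iff₀ (by positivity)]
        linarith)
    change T' ≤ B * bdist G (γ s) at hTle
    change ∀ v ∈ Set.Icc 0 T', g v ∈ G ∧ bdist G (γ s) ≤ B * bdist G (g v) at hgG
    have hsd : bdist G (γ s) ≤ 3 / 2 * R := by
      have := bdist_le_add G (γ s) x
      linarith
    have hT'R : T' ≤ 3 / 2 * (B * R) := by
      calc T' ≤ B * bdist G (γ s) := hTle
        _ ≤ B * (3 / 2 * R) := by gcongr
        _ = _ := by ring
    refine ⟨T + T', by linarith, hc.append hg hT' h0 h1 fun v hv => ⟨(hgG v hv).1, ?_⟩⟩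
    have hlow : R ≤ 2 * A * (B * bdist G (g v)) := by
      calc R = 2 * dist (γ s) x := by linarith
        _ ≤ 2 * (A * bdist G (γ s)) := by gcongr; exact hcar s (hst.trans ht) s (le_refl _)
        _ = 2 * A * bdist G (γ s) := by ring
        _ ≤ _ := by gcongr; exact (hgG v hv).2
    calc T + v ≤ 4 * (B * R) := by linarith [hv.2]
      _ ≤ 4 * (B * (2 * A * (B * bdist G (g v)))) := by gcongr
      _ = 8 * A * B ^ 2 * bdist G (g v) := by ring

/-- The conclusion of `IsNatural.carrotJoined_of_le` with the number of pieces chosen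
appropriately for a carrot contained in the ball of radius `D` about its vertex. -/
lemma IsNatural.carrotJoined {A : ℝ} (hA : 1 ≤ A) {ψ : ℝ≥0 → ℝ≥0} {G : Set E}
    (hψ : IsNatural ψ G) (hpos : ∀ z ∈ G, 0 < bdist G z) {x y : E} (γ : Path x y)
    (hγ : ∀ t, γ t ∈ G) {t₀ : unitInterval}
    (hcar : ∀ t ≤ t₀, ∀ s ≤ t, dist (γ s) x ≤ A * bdist G (γ t)) {D : ℝ}
    (hxD : bdist G x / 2 ≤ D) (hD : ∀ s ≤ t₀, dist (γ s) x ≤ D) :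
    ∃ T ≤ 8 * naturalBound A ψ * D,
      CarrotJoined (8 * A * naturalBound A ψ ^ 2) G x (γ t₀) T := by
  have hB1 : 1 ≤ naturalBound A ψ := one_le_naturalBound A ψ
  have hδ : 0 < bdist G x := by simpa using hpos _ (hγ 0)
  obtain ⟨n, hn1, hn2⟩ := exists_nat_pow_near (x := 2 * D / bdist G x) (y := (2 : ℝ))
    (by rw [le_div_iff₀ hδ]; linarith) (by norm_num)
  rw [le_div_iff₀ hδ] at hn1
  rw [div_lt_iff₀ hδ] at hn2
  obtain ⟨T, hT, hc⟩ := hψ.carrotJoined_of_le hA hpos γ hγ hcar (n + 1) t₀ (le_refl _)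
    fun s hs => by have := hD s hs; linarith
  refine ⟨T, hT.trans ?_, hc⟩
  rw [pow_succ]
  calc 2 * naturalBound A ψ * (2 ^ n * 2 * bdist G x)
      = 4 * naturalBound A ψ * (2 ^ n * bdist G x) := by ring
    _ ≤ 4 * naturalBound A ψ * (2 * D) := by gcongr
    _ = _ := by ring

lemma isBounded_image_path {x y : E} (γ : Path x y) (S : Set unitInterval) :
    Bornology.IsBounded (γ '' S) :=
  (isCompact_range γ.continuous).isBounded.subset (Set.image_subset_range _ _)

/-- The two subcurves of a diameter cigar up to the time when their diameters balance are diameter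
carrots. -/
lemma exists_bisecting_time {A : ℝ} {G : Set E} {x y : E} (γ : Path x y)
    (hγ : ∀ t, min (Metric.diam (γ '' Set.Iic t)) (Metric.diam (γ '' Set.Ici t))
      ≤ A * bdist G (γ t)) :
    ∃ t₀ : unitInterval, (∀ t ≤ t₀, ∀ s ≤ t, dist (γ s) x ≤ A * bdist G (γ t)) ∧
      ∀ t ≥ t₀, ∀ s ≥ t, dist (γ s) y ≤ A * bdist G (γ t) := by
  set F₁ : unitInterval → ℝ := fun t => Metric.diam (γ '' Set.Iic t) with hF₁
  set F₂ : unitInterval → ℝ := fun t => Metric.diam (γ '' Set.Ici t) with hF₂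
  have hm₁ : Monotone F₁ := fun s t hst =>
    Metric.diam_mono (Set.image_mono (Set.Iic_subset_Iic.2 hst)) (isBounded_image_path γ _)
  have hm₂ : Antitone F₂ := fun s t hst =>
    Metric.diam_mono (Set.image_mono (Set.Ici_subset_Ici.2 hst)) (isBounded_image_path γ _)
  have hd₁ : ∀ t, ∀ s ≤ t, dist (γ s) x ≤ F₁ t := fun t s hs =>
    Metric.dist_le_diam_of_mem (isBounded_image_path γ _) ⟨s, hs, rfl⟩
      ⟨0, (t.2.1 : (0 : unitInterval) ≤ t), γ.source⟩
  have hd₂ : ∀ t, ∀ s ≥ t, dist (γ s) y ≤ F₂ t := fun t s hs =>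
    Metric.dist_le_diam_of_mem (isBounded_image_path γ _) ⟨s, hs, rfl⟩
      ⟨1, (t.2.2 : t ≤ (1 : unitInterval)), γ.target⟩
  set W : Set unitInterval := {t | F₁ t ≤ F₂ t} with hW
  have hbd : Continuous fun t => A * bdist G (γ t) :=
    continuous_const.mul ((Metric.continuous_infDist_pt _).comp γ.continuous)
  -- both carrot conditions are closed in `t`, so it suffices to have them on either side of `t₀`
  have hC₁ : IsClosed {t : unitInterval | ∀ s, dist (γ (min s t)) x ≤ A * bdist G (γ t)} := by
    simp only [Set.ofPred_forall]
    exact isClosed_iInter fun s => isClosed_le (by fun_prop) hbd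
  have hC₂ : IsClosed {t : unitInterval | ∀ s, dist (γ (max s t)) y ≤ A * bdist G (γ t)} := by
    simp only [Set.ofPred_forall]
    exact isClosed_iInter fun s => isClosed_le (by fun_prop) hbd
  have hA0 : ∀ t, 0 ≤ A * bdist G (γ t) := fun t =>
    le_trans (le_min Metric.diam_nonneg Metric.diam_nonneg) (hγ t)
  set t₀ := sSup W
  have hlt : ∀ t < t₀, ∀ s, dist (γ (min s t)) x ≤ A * bdist G (γ t) := by
    intro t ht s
    obtain ⟨t', ht', htt'⟩ := lt_sSup_iff.1 ht
    have h1 : F₁ t ≤ F₂ t := (hm₁ htt'.le).trans (le_trans ht' (hm₂ htt'.le))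
    have h2 := hγ t
    rw [min_eq_left h1] at h2
    exact (hd₁ t _ (min_le_right _ _)).trans h2
  have hgt : ∀ t > t₀, ∀ s, dist (γ (max s t)) y ≤ A * bdist G (γ t) := by
    intro t ht s
    have h1 : ¬ F₁ t ≤ F₂ t := fun h => absurd (le_sSup (show t ∈ W from h)) (not_le.2 ht)
    have h2 := hγ t
    rw [min_eq_right (not_le.1 h1).le] at h2
    exact (hd₂ t _ (le_max_right _ _)).trans h2
  have h₁ : ∀ s, dist (γ (min s t₀)) x ≤ A * bdist G (γ t₀) := by
    rcases eq_or_ne t₀ 0 with h | h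
    · intro s
      have : min s t₀ = 0 := by rw [h]; exact min_eq_right s.2.1
      rw [this, γ.source, dist_self]
      exact hA0 _
    · have hne : (Set.Iio t₀).Nonempty := ⟨0, unitInterval.pos_iff_ne_zero.2 h⟩
      have : t₀ ∈ closure (Set.Iio t₀) := by
        rw [closure_Iio' hne]; exact le_refl t₀
      exact hC₁.closure_subset_iff.2 (fun t ht => hlt t ht) this
  have h₂ : ∀ s, dist (γ (max s t₀)) y ≤ A * bdist G (γ t₀) := by
    rcases eq_or_ne t₀ 1 with h | h
    · intro s
      have : max s t₀ = 1 := by rw [h]; exact max_eq_right s.2.2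
      rw [this, γ.target, dist_self]
      exact hA0 _
    · have hne : (Set.Ioi t₀).Nonempty := ⟨1, unitInterval.lt_one_iff_ne_one.2 h⟩
      have : t₀ ∈ closure (Set.Ioi t₀) := by
        rw [closure_Ioi' hne]; exact le_refl t₀
      exact hC₂.closure_subset_iff.2 (fun t ht => hgt t ht) this
  refine ⟨t₀, fun t ht s hs => ?_, fun t ht s hs => ?_⟩
  · have := (ht.lt_or_eq).elim (fun h => hlt t h s) (fun h => h ▸ h₁ s)
    rwa [min_eq_left hs] at this
  · have := (ht.lt_or_eq).elim (fun h => hgt t h s) (fun h => h ▸ h₂ s)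
    rwa [max_eq_left hs] at this

/-- In a natural domain, points joined by a diameter cigar are joined by a length cigar, provided
that they are not too close to each other. -/
lemma DiamJoined.lengthJoined {A : ℝ} (hA : 1 ≤ A) {ψ : ℝ≥0 → ℝ≥0} {G : Set E}
    (hψ : IsNatural ψ G) (hpos : ∀ z ∈ G, 0 < bdist G z) {x y : E} (h : DiamJoined A G x y)
    (hxy : max (bdist G x) (bdist G y) / 2 ≤ dist x y) :
    LengthJoined (16 * A * naturalBound A ψ ^ 2) G x y := by
  obtain ⟨γ, hγ, hcig, hturn⟩ := h
  obtain ⟨t₀, h₁, h₂⟩ := exists_bisecting_time γ hcig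
  have hB1 : 1 ≤ naturalBound A ψ := one_le_naturalBound A ψ
  have hAd : dist x y ≤ A * dist x y := le_mul_of_one_le_left dist_nonneg hA
  have hrange : ∀ s t, dist (γ s) (γ t) ≤ A * dist x y := fun s t =>
    (Metric.dist_le_diam_of_mem (isCompact_range γ.continuous).isBounded ⟨s, rfl⟩ ⟨t, rfl⟩).trans
      hturn
  obtain ⟨T, hT, hc⟩ := hψ.carrotJoined hA hpos γ hγ h₁ (D := A * dist x y)
    (by linarith [le_max_left (bdist G x) (bdist G y)])
    fun s _ => by simpa using hrange s 0
  obtain ⟨T', hT', hc'⟩ := hψ.carrotJoined hA hpos γ.symm (fun t => hγ _)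
    (t₀ := unitInterval.symm t₀) (D := A * dist x y)
    (fun t ht s hs => h₂ _ (unitInterval.le_symm_comm.1 ht) _ (unitInterval.symm_le_symm.2 hs))
    (by linarith [le_max_right (bdist G x) (bdist G y)])
    fun s _ => by simpa using hrange (unitInterval.symm s) 1
  rw [Path.symm_apply, Function.comp_apply, unitInterval.symm_symm] at hc'
  refine LengthJoined.of_carrots hc hc' ?_ ?_
  · have : 0 ≤ A * naturalBound A ψ ^ 2 := by positivity
    linarith
  · have : naturalBound A ψ ≤ naturalBound A ψ ^ 2 := by nlinarith
    have h0 : 0 ≤ A * dist x y := by positivity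
    calc T + T' ≤ 16 * naturalBound A ψ * (A * dist x y) := by linarith
      _ ≤ 16 * naturalBound A ψ ^ 2 * (A * dist x y) := by gcongr
      _ = _ := by ring

end Natural

/-! ### Cross ratios and cigars -/

section CrossRatio

variable {X : Type u} [MetricSpace X]

lemma not_crossRatio_large_of_turning_aux {A : ℝ} (hA : 1 ≤ A) {x₁ x₂ x a c : X}
    (hx₁ : dist x x₁ ≤ A * dist x₁ x₂) (hc : dist x x₁ ≤ A * dist x c) (hax : 0 < dist x a)
    (h₁ : 100 * A ^ 3 * (dist a x₁ * dist c x) < dist a x * dist c x₁)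
    (h₂ : 100 * A ^ 3 * (dist a x₂ * dist c x) < dist a x * dist c x₂) : False := by
  have t1 := dist_triangle c x x₁
  have t2 := dist_triangle a x₁ x
  have t3 := dist_triangle_left x₁ x₂ a
  have t4 := dist_triangle4 c x a x₂
  rw [dist_comm x₁ x] at t2
  rw [dist_comm x a] at t4 hax
  rw [dist_comm x c] at hc
  have t5 := dist_triangle_left x x₁ a
  have q0 : 0 ≤ dist a x₁ := dist_nonneg
  have r0 : 0 ≤ dist c x := dist_nonneg
  set p := dist a x
  set q := dist a x₁
  set r := dist c x
  set w := dist c x₁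
  set p₂ := dist a x₂
  set w₂ := dist c x₂
  have hA2 : A ≤ A ^ 2 := by nlinarith
  have hA3 : A ^ 2 ≤ A ^ 3 := by nlinarith [mul_nonneg (sq_nonneg A) (sub_nonneg.2 hA)]
  have hArr : r ≤ A * r := le_mul_of_one_le_left r0 hA
  have hw : w ≤ 2 * (A * r) := by linarith
  have hr : 0 < r := by
    rcases r0.eq_or_lt with e | e
    · rw [← e] at hw h₁
      have := mul_nonneg hax.le (show 0 ≤ 0 - w by linarith)
      linarith
    · exact e
  -- `a` is much closer to `x₁` than to `x`
  have hq : 50 * (A * (A * q)) < p := by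
    have h : r * (2 * A) * (50 * (A * (A * q))) < r * (2 * A) * p := by
      calc _ = 100 * A ^ 3 * (q * r) := by ring
        _ < p * w := h₁
        _ ≤ p * (2 * (A * r)) := by gcongr
        _ = _ := by ring
    exact lt_of_mul_lt_mul_left h (by positivity)
  have hAq : q ≤ A * q := le_mul_of_one_le_left q0 hA
  have hAAq : A * q ≤ A * (A * q) := le_mul_of_one_le_left (by positivity) hA
  have hp₂ : p ≤ 2 * (A * p₂) := by
    have : A * dist x₁ x₂ ≤ A * (q + p₂) := by gcongr
    linarith
  have hpr : p ≤ 2 * (A * r) := by linarith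
  have hfin : 100 * A ^ 3 * (p₂ * r) < 8 * A ^ 2 * (p₂ * r) := by
    calc 100 * A ^ 3 * (p₂ * r) < p * w₂ := h₂
      _ ≤ p * (3 * (A * r) + p₂) := by gcongr; linarith
      _ = p * (3 * (A * r)) + p * p₂ := by ring
      _ ≤ 2 * (A * p₂) * (3 * (A * r)) + 2 * (A * r) * p₂ := by gcongr
      _ = 6 * A ^ 2 * (p₂ * r) + 2 * A * (p₂ * r) := by ring
      _ ≤ 6 * A ^ 2 * (p₂ * r) + 2 * A ^ 2 * (p₂ * r) := by gcongr
      _ = _ := by ring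
  have h0 : 0 ≤ p₂ * r := by positivity
  have : 8 * A ^ 2 * (p₂ * r) ≤ 100 * A ^ 3 * (p₂ * r) := by gcongr; linarith [sq_nonneg A]
  linarith

/-- If `x` lies on a uniform curve from `x₁` to `x₂`, then the cross ratios of `x₁, x, a, c` and
of `x₂, x, a, c` are not both large. -/
lemma not_crossRatio_large_of_turning {A : ℝ} (hA : 1 ≤ A) {x₁ x₂ x a c : X}
    (hx₁ : dist x x₁ ≤ A * dist x₁ x₂) (hx₂ : dist x x₂ ≤ A * dist x₁ x₂)
    (hcig : dist x x₁ ≤ A * dist x c ∨ dist x x₂ ≤ A * dist x c) (hax : 0 < dist x a)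
    (h₁ : 100 * A ^ 3 * (dist a x₁ * dist c x) < dist a x * dist c x₁)
    (h₂ : 100 * A ^ 3 * (dist a x₂ * dist c x) < dist a x * dist c x₂) : False := by
  rcases hcig with h | h
  · exact not_crossRatio_large_of_turning_aux hA hx₁ h hax h₁ h₂
  · rw [dist_comm x₁] at hx₂
    exact not_crossRatio_large_of_turning_aux hA hx₂ h hax h₂ h₁

lemma not_crossRatio_large_of_cigar_aux {A : ℝ} (hA : 1 ≤ A) {x₁ x₂ x y z a c : X}
    (hx₁ : dist x x₁ ≤ A * dist x₁ x₂)
    (hy : dist y x₁ ≤ A * dist y c ∨ dist y x ≤ A * dist y c)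
    (hz : dist z x₂ ≤ A * dist z c ∨ dist z x ≤ A * dist z c)
    (hxa : dist x y ≤ A * dist x a) (hcx : 0 < dist c x)
    (h₁ : 100 * A ^ 3 * (dist a x * dist c y) < dist a y * dist c x)
    (h₂ : 100 * A ^ 3 * (dist a x * dist c z) < dist a z * dist c x) : False := by
  have t1 := dist_triangle a x y
  have t2 := dist_triangle c y x
  have t3 := dist_triangle4 a x c z
  have t6 := dist_triangle4 c y x₁ x
  have t7 := dist_triangle c z x
  rw [dist_comm x c] at t3
  rw [dist_comm x₁ x] at t6
  rw [dist_comm y x] at t2 hy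
  rw [dist_comm y c] at hy
  rw [dist_comm z c] at hz
  rw [dist_comm x a] at hxa
  have p0 : 0 ≤ dist a x := dist_nonneg
  have yc0 : 0 ≤ dist c y := dist_nonneg
  have zc0 : 0 ≤ dist c z := dist_nonneg
  set p := dist a x
  set r := dist c x
  set yc := dist c y
  set zc := dist c z
  have hAp : p ≤ A * p := le_mul_of_one_le_left p0 hA
  have hAr : r ≤ A * r := le_mul_of_one_le_left hcx.le hA
  have hAy : yc ≤ A * yc := le_mul_of_one_le_left yc0 hA
  have hAAy : A * yc ≤ A * (A * yc) := le_mul_of_one_le_left (by positivity) hA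
  have hAz : zc ≤ A * zc := le_mul_of_one_le_left zc0 hA
  have hAAz : A * zc ≤ A * (A * zc) := le_mul_of_one_le_left (by positivity) hA
  have hay : dist a y ≤ 2 * (A * p) := by linarith
  have hp : 0 < p := by
    rcases p0.eq_or_lt with e | e
    · rw [← e] at hay h₁
      have := mul_nonneg hcx.le (show 0 ≤ 0 - dist a y by linarith)
      linarith
    · exact e
  -- `y` is close to `c`, hence it comes shortly after `x₁`
  have hyc : 50 * (A * (A * yc)) < r := by
    have h : p * (2 * A) * (50 * (A * (A * yc))) < p * (2 * A) * r := by
      calc _ = 100 * A ^ 3 * (p * yc) := by ring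
        _ < dist a y * r := h₁
        _ ≤ 2 * (A * p) * r := by gcongr
        _ = _ := by ring
    exact lt_of_mul_lt_mul_left h (by positivity)
  have hy' : dist y x₁ ≤ A * yc := hy.resolve_right fun h => by linarith
  have hrp : r ≤ 2 * (A * p) := by linarith
  -- `z` is close to `c` as well, hence it comes shortly before `x₂`
  have hzc : 32 * (A * (A * zc)) < r := by
    have h : p * (3 * A) * (32 * (A * (A * zc))) < p * (3 * A) * r := by
      have e1 : 100 * A ^ 3 * (p * zc) < p * (3 * A) * r + 2 * A * (p * zc) := by
        calc 100 * A ^ 3 * (p * zc) < dist a z * r := h₂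
          _ ≤ (3 * (A * p) + zc) * r := by gcongr; linarith
          _ = p * (3 * A) * r + zc * r := by ring
          _ ≤ p * (3 * A) * r + zc * (2 * (A * p)) := by gcongr
          _ = _ := by ring
      have e2 : 2 * A * (p * zc) ≤ 2 * A ^ 3 * (p * zc) := by
        gcongr
        exact le_self_pow₀ hA (by norm_num)
      have e3 : 0 ≤ A ^ 3 * (p * zc) := by positivity
      calc _ = 96 * (A ^ 3 * (p * zc)) := by ring
        _ < _ := by linarith
    exact lt_of_mul_lt_mul_left h (by positivity)
  have hz' : dist z x₂ ≤ A * zc := hz.resolve_right fun h => by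
    rw [dist_comm z x] at h t7
    linarith
  have h12 : A * dist x₁ x₂ ≤ A * (2 * (A * yc) + 2 * (A * zc)) := by
    gcongr
    linarith [dist_triangle4 x₁ y z x₂, dist_triangle_left y z c, dist_comm x₁ y]
  linarith [dist_comm y x₁]

/-- If `y`, `x`, `z` are successive points of a uniform curve from `x₁` to `x₂`, then the cross
ratios of `x, y, a, c` and of `x, z, a, c` are not both large. -/
lemma not_crossRatio_large_of_cigar {A : ℝ} (hA : 1 ≤ A) {x₁ x₂ x y z a c : X}
    (hx₁ : dist x x₁ ≤ A * dist x₁ x₂) (hx₂ : dist x x₂ ≤ A * dist x₁ x₂)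
    (hy : dist y x₁ ≤ A * dist y c ∨ dist y x ≤ A * dist y c)
    (hz : dist z x₂ ≤ A * dist z c ∨ dist z x ≤ A * dist z c)
    (hxa : dist x y ≤ A * dist x a ∨ dist x z ≤ A * dist x a) (hcx : 0 < dist c x)
    (h₁ : 100 * A ^ 3 * (dist a x * dist c y) < dist a y * dist c x)
    (h₂ : 100 * A ^ 3 * (dist a x * dist c z) < dist a z * dist c x) : False := by
  rcases hxa with h | h
  · exact not_crossRatio_large_of_cigar_aux hA hx₁ hy hz h hcx h₁ h₂
  · rw [dist_comm x₁] at hx₂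
    exact not_crossRatio_large_of_cigar_aux hA hx₂ hz hy h hcx h₂ h₁

end CrossRatio

section Quasimobius

variable {X : Type u} {Y : Type v} [MetricSpace X] [MetricSpace Y]

/-- The relative quasimöbius condition for two points of `S` and two points outside `S`, with
denominators cleared. It extends to degenerate quadruples, for which both cross ratios are `1`. -/
lemma IsQuasimobiusRel.mul_dist_le {θ : ℝ≥0 ≃ₜ ℝ≥0} {S : Set X} {f : X ≃ₜ Y}
    (hf : IsQuasimobiusRel θ S f) {K Θ : ℝ≥0} (h1Θ : 1 ≤ Θ) (hΘ : ∀ t ≤ K, θ t ≤ Θ) {p q a b : X}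
    (ha : a ∈ S) (hb : b ∈ S) (hp : p ∉ S) (hq : q ∉ S)
    (h : dist a q * dist b p ≤ K * (dist a p * dist b q)) :
    dist (f a) (f q) * dist (f b) (f p) ≤ Θ * (dist (f a) (f p) * dist (f b) (f q)) := by
  have hΘ1 : (1 : ℝ) ≤ Θ := by exact_mod_cast h1Θ
  have hap : a ≠ p := fun e => hp (e ▸ ha)
  have haq : a ≠ q := fun e => hq (e ▸ ha)
  have hbp : b ≠ p := fun e => hp (e ▸ hb)
  have hbq : b ≠ q := fun e => hq (e ▸ hb)
  rcases eq_or_ne a b with rfl | hab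
  · rw [mul_comm (dist (f a) (f p))]
    exact le_mul_of_one_le_left (by positivity) hΘ1
  rcases eq_or_ne p q with rfl | hpq
  · exact le_mul_of_one_le_left (by positivity) hΘ1
  have hpos : ∀ {u v : X}, u ≠ v → 0 < nndist u v := fun h => by
    rw [← NNReal.coe_pos, coe_nndist]; exact dist_pos.2 h
  have hpos' : ∀ {u v : X}, u ≠ v → 0 < nndist (f u) (f v) := fun h => by
    rw [← NNReal.coe_pos, coe_nndist]; exact dist_pos.2 (f.injective.ne h)
  have h1 := hf a p q b (by simp [hap, haq, hab, hpq, hbp.symm, hbq.symm]) (Or.inl ⟨ha, hb⟩)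
  have h2 : crossRatio a p q b ≤ K := by
    rw [crossRatio, div_mul_div_comm, div_le_iff₀ (mul_pos (hpos hap) (hpos hbq.symm)),
      nndist_comm p b, nndist_comm q b]
    exact_mod_cast h
  have h3 := h1.trans (hΘ _ h2)
  rw [crossRatio, div_mul_div_comm, div_le_iff₀ (mul_pos (hpos' hap) (hpos' hbq.symm)),
    nndist_comm (f p), nndist_comm (f q)] at h3
  exact_mod_cast h3

end Quasimobius

/-! ### Images of cigars under relatively quasimöbius maps -/

section Image

variable {X : Type u} {Y : Type v} [MetricSpace X] [MetricSpace Y]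

/-- A curve satisfying the diameter cigar and turning conditions, where `S` plays the role of the
boundary: the curve misses `S`, its points are not farther from its end points than `A` times the
distance of the latter, and of the two subcurves cut off by a point at least one stays close to
this point in comparison with the distances of the point to the points of `S`. -/
def IsCigarRel (A : ℝ) (S : Set X) {x₁ x₂ : X} (γ : Path x₁ x₂) : Prop :=
  (∀ t, γ t ∉ S) ∧
    (∀ t, dist (γ t) x₁ ≤ A * dist x₁ x₂ ∧ dist (γ t) x₂ ≤ A * dist x₁ x₂) ∧
    ∀ t, (∀ s ≤ t, ∀ c ∈ S, dist (γ t) (γ s) ≤ A * dist (γ t) c) ∨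
      ∀ s ≥ t, ∀ c ∈ S, dist (γ t) (γ s) ≤ A * dist (γ t) c

variable {A : ℝ} {θ : ℝ≥0 ≃ₜ ℝ≥0} {S : Set X} {f : X ≃ₜ Y} {Θ : ℝ≥0} {x₁ x₂ : X}
  {γ : Path x₁ x₂}

/-- The contrapositive of `IsQuasimobiusRel.mul_dist_le` with `K = 100 A ^ 3`. -/
lemma IsQuasimobiusRel.lt_mul_dist (hA : 1 ≤ A) (hf : IsQuasimobiusRel θ S f) (h1Θ : 1 ≤ Θ)
    (hΘ : ∀ t ≤ (100 * A ^ 3).toNNReal, θ t ≤ Θ) {p q a b : X}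
    (ha : a ∈ S) (hb : b ∈ S) (hp : p ∉ S) (hq : q ∉ S)
    (h : Θ * (dist (f a) (f p) * dist (f b) (f q)) < dist (f a) (f q) * dist (f b) (f p)) :
    100 * A ^ 3 * (dist a p * dist b q) < dist a q * dist b p := by
  by_contra hle
  push Not at hle
  rw [← Real.coe_toNNReal (100 * A ^ 3) (by positivity)] at hle
  exact absurd (hf.mul_dist_le h1Θ hΘ ha hb hp hq hle) (not_le.2 h)

/-- The image of a cigar satisfies the turning condition, provided that its end points are close to
each other in comparison with the size of the boundary, which is witnessed by `c`, and not too
close in comparison with their distance to the boundary, which is witnessed by `a`. At a first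
point violating the condition the boundary point `f c` could be taken for the point at infinity in
cross ratios. -/
lemma IsCigarRel.dist_image_le (hA : 1 ≤ A) (hf : IsQuasimobiusRel θ S f) (h1Θ : 1 ≤ Θ)
    (hΘ : ∀ t ≤ (100 * A ^ 3).toNNReal, θ t ≤ Θ) (hγ : IsCigarRel A S γ) {k : ℝ}
    (hk : 100 * Θ ≤ k) {a c : X} (ha : a ∈ S) (hc : c ∈ S)
    (hafx : dist (f a) (f x₁) ≤ 4 * dist (f x₁) (f x₂))
    (hcfx : 2 * k * dist (f x₁) (f x₂) ≤ dist (f c) (f x₁)) (t : unitInterval) :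
    dist (f (γ t)) (f x₁) ≤ k * dist (f x₁) (f x₂) := by
  have hS₁ : x₁ ∉ S := by simpa using hγ.1 0
  have hS₂ : x₂ ∉ S := by simpa using hγ.1 1
  have hax : 0 < dist (f a) (f x₁) := dist_pos.2 (f.injective.ne fun e => hS₁ (e ▸ ha))
  have h1Θ' : (1 : ℝ) ≤ Θ := by exact_mod_cast h1Θ
  have hcont : Continuous fun t => dist (f (γ t)) (f x₁) := by
    have := f.continuous
    fun_prop
  set ρ := dist (f x₁) (f x₂)
  have hρ : 0 < ρ := by linarith
  have hk0 : 0 ≤ k := by linarith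
  by_contra hlt
  push Not at hlt
  obtain ⟨s, -, hs, -⟩ := exists_first_exit hcont
    (by simp only [γ.source, dist_self]; positivity) hlt
  have hSx : γ s ∉ S := hγ.1 s
  have hturn := hγ.2.1 s
  have hcig : dist (γ s) x₁ ≤ A * dist (γ s) c ∨ dist (γ s) x₂ ≤ A * dist (γ s) c :=
    (hγ.2.2 s).imp (fun h => by simpa using h 0 s.2.1 c hc) (fun h => by simpa using h 1 s.2.2 c hc)
  set x := γ s
  have t1 := dist_triangle (f x) (f a) (f x₁)
  have t2 := dist_triangle (f a) (f x₁) (f x₂)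
  have t3 := dist_triangle_right (f c) (f x) (f x₁)
  have t4 := dist_triangle_right (f c) (f x₁) (f x₂)
  rw [dist_comm (f x) (f a)] at t1
  have hΘρ : ρ ≤ Θ * ρ := le_mul_of_one_le_left hρ.le h1Θ'
  have hkρ : 100 * (Θ * ρ) ≤ k * ρ := by rw [← mul_assoc]; gcongr
  have hc0 : 0 < dist (f c) (f x₁) := by linarith
  have hlow : 96 * (Θ * ρ) ≤ dist (f a) (f x) := by linarith
  refine not_crossRatio_large_of_turning hA hturn.1 hturn.2 hcig
    (dist_pos.2 fun e => hSx (e ▸ ha)) (a := a) (c := c)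
    (hf.lt_mul_dist hA h1Θ hΘ ha hc hS₁ hSx ?_) (hf.lt_mul_dist hA h1Θ hΘ ha hc hS₂ hSx ?_)
  · calc Θ * (dist (f a) (f x₁) * dist (f c) (f x))
        ≤ Θ * ((4 * ρ) * (2 * dist (f c) (f x₁))) := by gcongr; linarith
      _ = 8 * (Θ * ρ) * dist (f c) (f x₁) := by ring
      _ < 96 * (Θ * ρ) * dist (f c) (f x₁) := by gcongr; norm_num
      _ ≤ _ := by gcongr
  · have hc2 : 0 < dist (f c) (f x₂) := by linarith [dist_comm (f x₁) (f x₂)]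
    calc Θ * (dist (f a) (f x₂) * dist (f c) (f x))
        ≤ Θ * ((5 * ρ) * (2 * dist (f c) (f x₂))) := by gcongr <;> linarith
      _ = 10 * (Θ * ρ) * dist (f c) (f x₂) := by ring
      _ < 96 * (Θ * ρ) * dist (f c) (f x₂) := by gcongr; norm_num
      _ ≤ _ := by gcongr

/-- The image of a cigar satisfies the cigar condition at those points whose distance to the
boundary, comparable to `δ` by the presence of `a`, is small in comparison with the size of the
boundary, which is witnessed by `c`. -/
lemma IsCigarRel.dist_image_le_or (hA : 1 ≤ A) (hf : IsQuasimobiusRel θ S f) (h1Θ : 1 ≤ Θ)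
    (hΘ : ∀ t ≤ (100 * A ^ 3).toNNReal, θ t ≤ Θ) (hγ : IsCigarRel A S γ) {k : ℝ}
    (hk : 100 * Θ ≤ k) {a c : X} (ha : a ∈ S) (hc : c ∈ S) {δ : ℝ} (t : unitInterval)
    (hafx : dist (f a) (f (γ t)) ≤ 2 * δ)
    (hcfx : 2 * k * δ ≤ dist (f c) (f (γ t))) :
    (∀ s ≤ t, dist (f (γ s)) (f (γ t)) ≤ k * δ) ∨
      ∀ s ≥ t, dist (f (γ s)) (f (γ t)) ≤ k * δ := by
  have hax : 0 < dist (f a) (f (γ t)) := dist_pos.2 (f.injective.ne fun e => hγ.1 t (e ▸ ha))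
  have h1Θ' : (1 : ℝ) ≤ Θ := by exact_mod_cast h1Θ
  have hδ : 0 < δ := by linarith
  have hcont : Continuous fun s => dist (f (γ s)) (f (γ t)) := by
    have := f.continuous
    fun_prop
  have hk0 : 0 ≤ k * δ := by
    have : 0 ≤ k := by linarith
    positivity
  by_contra hcon
  push Not at hcon
  obtain ⟨⟨s₁, hs₁, h₁⟩, s₂, hs₂, h₂⟩ := hcon
  obtain ⟨u, hu, hfu⟩ := intermediate_value_Icc' hs₁ hcont.continuousOn
    (show k * δ ∈ Set.Icc _ _ from ⟨by simpa using hk0, h₁.le⟩)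
  obtain ⟨v, hv, hfv⟩ := intermediate_value_Icc hs₂ hcont.continuousOn
    (show k * δ ∈ Set.Icc _ _ from ⟨by simpa using hk0, h₂.le⟩)
  have hΘδ : δ ≤ Θ * δ := le_mul_of_one_le_left hδ.le h1Θ'
  have hkδ : 100 * (Θ * δ) ≤ k * δ := by rw [← mul_assoc]; gcongr
  have hc0 : 0 < dist (f c) (f (γ t)) := by linarith
  have key : ∀ s, dist (f (γ s)) (f (γ t)) = k * δ →
      Θ * (dist (f a) (f (γ t)) * dist (f c) (f (γ s))) <
        dist (f a) (f (γ s)) * dist (f c) (f (γ t)) := by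
    intro s hs
    have t1 := dist_triangle_left (f (γ s)) (f (γ t)) (f a)
    have t2 := dist_triangle_right (f c) (f (γ s)) (f (γ t))
    have hlow : 98 * (Θ * δ) ≤ dist (f a) (f (γ s)) := by linarith
    calc Θ * (dist (f a) (f (γ t)) * dist (f c) (f (γ s)))
        ≤ Θ * ((2 * δ) * (2 * dist (f c) (f (γ t)))) := by gcongr; linarith
      _ = 4 * (Θ * δ) * dist (f c) (f (γ t)) := by ring
      _ < 98 * (Θ * δ) * dist (f c) (f (γ t)) := by gcongr; norm_num
      _ ≤ _ := by gcongr
  refine not_crossRatio_large_of_cigar hA (hγ.2.1 t).1 (hγ.2.1 t).2 (y := γ u) (z := γ v)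
    (a := a) (c := c) ?_ ?_ ?_ (dist_pos.2 fun e => hγ.1 t (e ▸ hc))
    (hf.lt_mul_dist hA h1Θ hΘ ha hc (hγ.1 t) (hγ.1 u) (key u hfu))
    (hf.lt_mul_dist hA h1Θ hΘ ha hc (hγ.1 t) (hγ.1 v) (key v hfv))
  · exact (hγ.2.2 u).imp (fun h => by simpa using h 0 u.2.1 c hc) fun h => h t hu.2 c hc
  · exact (hγ.2.2 v).symm.imp (fun h => by simpa using h 1 v.2.2 c hc) fun h => h t hv.1 c hc
  · exact (hγ.2.2 t).imp (fun h => h u hu.2 a ha) fun h => h v hv.1 a ha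

end Image

/-! ### Diameter cigars -/

section Diam

variable {E : Type u} [NormedAddCommGroup E]

lemma bdist_nonneg (G : Set E) (x : E) : 0 ≤ bdist G x := Metric.infDist_nonneg

lemma DiamJoined.mono {A B : ℝ} (hAB : A ≤ B) {G : Set E} {x y : E} (h : DiamJoined A G x y) :
    DiamJoined B G x y := by
  obtain ⟨γ, hγ, h1, h2⟩ := h
  exact ⟨γ, hγ, fun t => (h1 t).trans (mul_le_mul_of_nonneg_right hAB (bdist_nonneg _ _)),
    h2.trans (mul_le_mul_of_nonneg_right hAB dist_nonneg)⟩

lemma DiamJoined.symm {A : ℝ} {G : Set E} {x y : E} (h : DiamJoined A G x y) :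
    DiamJoined A G y x := by
  obtain ⟨γ, hγ, h1, h2⟩ := h
  have e1 : ∀ t, γ.symm '' Set.Iic t = γ '' Set.Ici (unitInterval.symm t) := by
    intro t
    ext z
    constructor
    · rintro ⟨s, hs, rfl⟩
      exact ⟨unitInterval.symm s, unitInterval.symm_le_symm.2 hs, rfl⟩
    · rintro ⟨s, hs, rfl⟩
      exact ⟨unitInterval.symm s, unitInterval.symm_le_comm.1 hs, by simp⟩
  have e2 : ∀ t, γ.symm '' Set.Ici t = γ '' Set.Iic (unitInterval.symm t) := by
    intro t
    ext z
    constructor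
    · rintro ⟨s, hs, rfl⟩
      exact ⟨unitInterval.symm s, unitInterval.symm_le_symm.2 hs, rfl⟩
    · rintro ⟨s, hs, rfl⟩
      exact ⟨unitInterval.symm s, unitInterval.le_symm_comm.1 hs, by simp⟩
  refine ⟨γ.symm, fun t => hγ _, fun t => ?_, ?_⟩
  · rw [e1, e2, min_comm]
    exact h1 _
  · rw [Path.symm_range, dist_comm]
    exact h2

lemma DiamJoined.of_dist_le {C : ℝ} (hC : 0 ≤ C) {G : Set E} {x y : E} (γ : Path x y)
    (hγ : ∀ t, γ t ∈ G) (hturn : ∀ t, dist (γ t) x ≤ C * dist x y)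
    (hcig : ∀ t, (∀ s ≤ t, dist (γ s) (γ t) ≤ C * bdist G (γ t)) ∨
      ∀ s ≥ t, dist (γ s) (γ t) ≤ C * bdist G (γ t)) : DiamJoined (2 * C) G x y := by
  refine ⟨γ, hγ, fun t => ?_, ?_⟩
  · have h0 := mul_nonneg hC (bdist_nonneg G (γ t))
    rcases hcig t with h | h
    · refine (min_le_left _ _).trans (Metric.diam_le_of_forall_dist_le (by linarith) ?_)
      rintro _ ⟨s, hs, rfl⟩ _ ⟨s', hs', rfl⟩
      linarith [dist_triangle_right (γ s) (γ s') (γ t), h s hs, h s' hs']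
    · refine (min_le_right _ _).trans (Metric.diam_le_of_forall_dist_le (by linarith) ?_)
      rintro _ ⟨s, hs, rfl⟩ _ ⟨s', hs', rfl⟩
      linarith [dist_triangle_right (γ s) (γ s') (γ t), h s hs, h s' hs']
  · have h0 : 0 ≤ C * dist x y := by positivity
    refine Metric.diam_le_of_forall_dist_le (by linarith) ?_
    rintro _ ⟨s, rfl⟩ _ ⟨s', rfl⟩
    linarith [dist_triangle_right (γ s) (γ s') x, hturn s, hturn s']

lemma LengthJoined.diamJoined {A : ℝ} (hA : 0 ≤ A) {G : Set E} {x y : E}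
    (h : LengthJoined A G x y) : DiamJoined A G x y := by
  obtain ⟨γ, hγ, h1, h2⟩ := h
  have key : ∀ (S : Set unitInterval) (r : ℝ), 0 ≤ r → eVariationOn γ S ≤ ENNReal.ofReal r →
      Metric.diam (γ '' S) ≤ r := by
    intro S r hr hS
    refine Metric.diam_le_of_forall_dist_le hr ?_
    rintro _ ⟨s, hs, rfl⟩ _ ⟨t, ht, rfl⟩
    rw [← edist_le_ofReal hr]
    exact (eVariationOn.edist_le γ hs ht).trans hS
  refine ⟨γ, hγ, fun t => ?_, ?_⟩
  · have h0 := mul_nonneg hA (bdist_nonneg G (γ t))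
    exact (min_le_iff.1 (h1 t)).elim (fun h => (min_le_left _ _).trans (key _ _ h0 h))
      fun h => (min_le_right _ _).trans (key _ _ h0 h)
  · rw [← Set.image_univ]
    exact key _ _ (by positivity) h2

/-- A diameter cigar satisfies the cigar condition relative to the boundary. -/
lemma isCigarRel_of_diam {A : ℝ} {G : Set E} (hGo : IsOpen G) {x₁ x₂ : closure G}
    (γ : Path (x₁ : E) x₂) (hγ : ∀ t, γ t ∈ G) (hA : 0 ≤ A)
    (hcig : ∀ t, min (Metric.diam (γ '' Set.Iic t)) (Metric.diam (γ '' Set.Ici t))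
      ≤ A * bdist G (γ t))
    (hturn : Metric.diam (Set.range γ) ≤ A * dist (x₁ : E) x₂) :
    ∃ α : Path x₁ x₂, (∀ t, (α t : E) ∈ G) ∧
      IsCigarRel A {x : closure G | (x : E) ∈ frontier G} α := by
  refine ⟨⟨⟨fun t => ⟨γ t, subset_closure (hγ t)⟩, by fun_prop⟩, by ext; simp, by ext; simp⟩,
    hγ, fun t ht => ?_, fun t => ⟨?_, ?_⟩, fun t => ?_⟩
  · exact (hGo.frontier_eq ▸ ht : γ t ∈ closure G \ G).2 (hγ t)
  · exact (Metric.dist_le_diam_of_mem (isCompact_range γ.continuous).isBounded ⟨t, rfl⟩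
      ⟨0, γ.source⟩).trans hturn
  · exact (Metric.dist_le_diam_of_mem (isCompact_range γ.continuous).isBounded ⟨t, rfl⟩
      ⟨1, γ.target⟩).trans hturn
  · refine (min_le_iff.1 (hcig t)).imp (fun h s hs c hc => ?_) (fun h s hs c hc => ?_)
    · refine (Metric.dist_le_diam_of_mem (isBounded_image_path γ _) ⟨t, ?_, rfl⟩
        ⟨s, hs, rfl⟩).trans (h.trans (mul_le_mul_of_nonneg_left (bdist_le_dist _ hc) hA))
      exact le_refl t
    · refine (Metric.dist_le_diam_of_mem (isBounded_image_path γ _) ⟨t, ?_, rfl⟩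
        ⟨s, hs, rfl⟩).trans (h.trans (mul_le_mul_of_nonneg_left (bdist_le_dist _ hc) hA))
      exact le_refl t

end Diam

/-! ### The radial retraction onto a ball -/

section Retraction

variable {E : Type u} [NormedAddCommGroup E] [NormedSpace ℝ E]

/-- The radial retraction of the space onto the closed ball of radius `R` about `b`. -/
noncomputable def radialRetraction (b : E) (R : ℝ) (x : E) : E :=
  b + (R / max R ‖x - b‖) • (x - b)

variable {b : E} {R : ℝ}

lemma continuous_radialRetraction (hR : 0 < R) : Continuous (radialRetraction b R) := by
  have : ∀ x, max R ‖x - b‖ ≠ 0 := fun x => (hR.trans_le (le_max_left _ _)).ne'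
  unfold radialRetraction
  fun_prop (disch := assumption)

lemma radialRetraction_of_le (hR : 0 < R) {x : E} (h : dist x b ≤ R) :
    radialRetraction b R x = x := by
  rw [dist_eq_norm] at h
  simp [radialRetraction, max_eq_left h, div_self hR.ne']

lemma dist_radialRetraction_of_ge (hR : 0 < R) {x : E} (h : R ≤ dist x b) :
    dist (radialRetraction b R x) b = R := by
  rw [dist_eq_norm] at h ⊢
  have h0 := hR.trans_le h
  rw [radialRetraction, add_sub_cancel_left, max_eq_right h, norm_smul, Real.norm_eq_abs,
    abs_of_nonneg (by positivity), div_mul_cancel₀ _ h0.ne']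

lemma dist_radialRetraction_le (hR : 0 < R) (x : E) : dist (radialRetraction b R x) b ≤ R := by
  rcases le_total R (dist x b) with h | h
  · exact (dist_radialRetraction_of_ge hR h).le
  · rwa [radialRetraction_of_le hR h]

lemma dist_radialRetraction_self (hR : 0 < R) {x : E} (h : R ≤ dist x b) :
    dist x (radialRetraction b R x) = dist x b - R := by
  rw [dist_eq_norm] at h
  have h0 := hR.trans_le h
  have : x - radialRetraction b R x = (1 - R / ‖x - b‖) • (x - b) := by
    rw [radialRetraction, max_eq_right h, sub_smul, one_smul]
    abel
  rw [dist_eq_norm, this, norm_smul, Real.norm_eq_abs,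
    abs_of_nonneg (sub_nonneg.2 (div_le_one_of_le₀ h h0.le)), sub_mul, one_mul,
    div_mul_cancel₀ _ h0.ne', dist_eq_norm]

lemma dist_radialRetraction_le_two_mul (hR : 0 < R) {x y : E} (hx : dist x b ≤ R) :
    dist (radialRetraction b R y) x ≤ 2 * dist y x := by
  rcases le_total R (dist y b) with h | h
  · have h1 := dist_radialRetraction_self hR h
    have h2 := dist_triangle y x b
    have h3 := dist_triangle_left (radialRetraction b R y) x y
    linarith
  · rw [radialRetraction_of_le hR h]
    linarith [dist_nonneg (x := y) (y := x)]

end Retraction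

/-! ### Diameter cigars in the image domain -/

section ImageDomain

variable {E : Type u} [NormedAddCommGroup E]
  {E' : Type v} [NormedAddCommGroup E'] [NormedSpace ℝ E']

/-- Points of the image domain that are not too close to each other are joined by a diameter cigar:
the image of a cigar, followed by a map `φ` that retracts `G'` to `G' ∩ B`. The hypotheses `hT` and
`hC` say that the boundary is large in comparison with the scale considered, or else the turning or
cigar condition holds trivially. -/
lemma DiamJoined.image {A : ℝ} (hA : 1 ≤ A) {θ : ℝ≥0 ≃ₜ ℝ≥0} {Θ : ℝ≥0} (h1Θ : 1 ≤ Θ)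
    (hΘ : ∀ t ≤ (100 * A ^ 3).toNNReal, θ t ≤ Θ) {G : Set E} {G' : Set E'} (hG : IsProperDomain G)
    (hG' : IsProperDomain G') (hU : IsDiameterUniform A G) {f : closure G ≃ₜ closure G'}
    (hfG : ∀ x, (f x : E') ∈ G' ↔ (x : E) ∈ G)
    (hf : IsQuasimobiusRel θ {x : closure G | (x : E) ∈ frontier G} f) {k C : ℝ}
    (hk : 100 * Θ ≤ k) (hC : 2 * k ≤ C) {φ : E' → E'} {B : Set E'} (hφ : Continuous φ)
    (hφB : ∀ u ∈ B, φ u = u) (hφL : ∀ u ∈ B, ∀ v, dist (φ v) u ≤ 2 * dist v u)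
    (hφG : ∀ v ∈ G', φ v ∈ G') {y₁ y₂ : E'} (hy₁ : y₁ ∈ G') (hy₂ : y₂ ∈ G') (hB₁ : y₁ ∈ B)
    (hB₂ : y₂ ∈ B) (hy : max (bdist G' y₁) (bdist G' y₂) / 2 ≤ dist y₁ y₂)
    (hT : (∃ c ∈ frontier G', 2 * k * dist y₁ y₂ ≤ dist c y₁) ∨
      ∀ v ∈ G', dist (φ v) y₁ ≤ C * dist y₁ y₂)
    (hCi : ∀ u ∈ G', (u ∈ B ∧ ∃ c ∈ frontier G', 2 * k * bdist G' u ≤ dist c u) ∨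
      ∀ v ∈ G', dist (φ v) (φ u) ≤ C * bdist G' (φ u)) :
    DiamJoined (2 * C) G' y₁ y₂ := by
  have h1Θ' : (1 : ℝ) ≤ Θ := by exact_mod_cast h1Θ
  have hC0 : 0 ≤ C := by linarith
  have hfr : ∀ c ∈ frontier G', ∃ a : closure G, (a : E) ∈ frontier G ∧ (f a : E') = c := by
    intro c hc
    have hfa : f (f.symm ⟨c, frontier_subset_closure hc⟩) = ⟨c, frontier_subset_closure hc⟩ :=
      f.apply_symm_apply _
    refine ⟨f.symm ⟨c, frontier_subset_closure hc⟩, ?_, by rw [hfa]⟩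
    rw [hG.1.frontier_eq]
    refine ⟨(f.symm _).2, fun h => ?_⟩
    have := (hfG _).2 h
    rw [hfa] at this
    exact (hG'.1.frontier_eq ▸ hc).2 this
  obtain ⟨x₁, rfl⟩ : ∃ x, (f x : E') = y₁ :=
    ⟨f.symm ⟨y₁, subset_closure hy₁⟩, by rw [f.apply_symm_apply]⟩
  obtain ⟨x₂, rfl⟩ : ∃ x, (f x : E') = y₂ :=
    ⟨f.symm ⟨y₂, subset_closure hy₂⟩, by rw [f.apply_symm_apply]⟩
  have hxG₁ : (x₁ : E) ∈ G := (hfG _).1 hy₁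
  have hxG₂ : (x₂ : E) ∈ G := (hfG _).1 hy₂
  obtain ⟨γ, hγ, hcig, hturn⟩ := hU.2 _ hxG₁ _ hxG₂
  obtain ⟨α, hαG, hα⟩ := isCigarRel_of_diam hG.1 γ hγ (by linarith) hcig hturn
  have hαG' : ∀ t, (f (α t) : E') ∈ G' := fun t => (hfG _).2 (hαG t)
  have hcont : Continuous fun t => φ (f (α t) : E') := by
    have := f.continuous
    fun_prop
  refine DiamJoined.of_dist_le hC0 ⟨⟨fun t => φ (f (α t)), hcont⟩, ?_, ?_⟩
    (fun t => hφG _ (hαG' t)) (fun t => ?_) (fun t => ?_)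
  · simp [hφB _ hB₁]
  · simp [hφB _ hB₂]
  · show dist (φ (f (α t))) (f x₁) ≤ C * dist (f x₁ : E') (f x₂)
    rcases hT with ⟨c, hc, hcy⟩ | h
    · obtain ⟨a', ha', haf⟩ := hG'.exists_frontier_lt hy₁
      obtain ⟨a, ha, rfl⟩ := hfr a' ha'
      obtain ⟨c, hcS, rfl⟩ := hfr c hc
      rw [dist_comm] at haf
      have hd := le_max_left (bdist G' (f x₁ : E')) (bdist G' (f x₂ : E'))
      have h1 : dist (f (α t) : E') (f x₁) ≤ k * dist (f x₁ : E') (f x₂) :=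
        hα.dist_image_le hA hf h1Θ hΘ hk ha hcS
          (show dist (f a : E') (f x₁) ≤ 4 * dist (f x₁ : E') (f x₂) by linarith) hcy t
      calc dist (φ (f (α t))) (f x₁) ≤ 2 * (k * dist (f x₁ : E') (f x₂)) :=
            (hφL _ hB₁ _).trans (by linarith)
        _ = 2 * k * dist (f x₁ : E') (f x₂) := by ring
        _ ≤ C * dist (f x₁ : E') (f x₂) := by gcongr
    · exact h _ (hαG' t)
  · show (∀ s ≤ t, dist (φ (f (α s))) (φ (f (α t))) ≤ C * bdist G' (φ (f (α t)))) ∨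
      ∀ s ≥ t, dist (φ (f (α s))) (φ (f (α t))) ≤ C * bdist G' (φ (f (α t)))
    rcases hCi _ (hαG' t) with ⟨hB, c, hc, hcy⟩ | h
    · rw [hφB _ hB]
      obtain ⟨a', ha', haf⟩ := hG'.exists_frontier_lt (hαG' t)
      obtain ⟨a, ha, rfl⟩ := hfr a' ha'
      obtain ⟨c, hcS, rfl⟩ := hfr c hc
      rw [dist_comm] at haf
      have hb := bdist_nonneg G' (f (α t) : E')
      have key : ∀ s, dist (f (α s)) (f (α t)) ≤ k * bdist G' (f (α t) : E') →
          dist (φ (f (α s))) (f (α t)) ≤ C * bdist G' (f (α t) : E') := fun s hs =>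
        calc dist (φ (f (α s))) (f (α t)) ≤ 2 * dist (f (α s)) (f (α t)) := hφL _ hB _
          _ ≤ 2 * (k * bdist G' (f (α t) : E')) := by gcongr
          _ = 2 * k * bdist G' (f (α t) : E') := by ring
          _ ≤ C * bdist G' (f (α t) : E') := by gcongr
      exact (hα.dist_image_le_or hA hf h1Θ hΘ hk ha hcS t haf.le hcy).imp
        (fun h s hs => key s (h s hs)) fun h s hs => key s (h s hs)
    · exact Or.inl fun s _ => h _ (hαG' s)

end ImageDomain

/-! ### Domains with bounded boundary -/

section Exterior

variable {E : Type u} [NormedAddCommGroup E] [NormedSpace ℝ E]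

/-- A domain with bounded boundary is contained in a ball or contains the complement of this
ball. -/
lemma IsProperDomain.subset_closedBall_or (hE : 1 < Module.rank ℝ E) {G : Set E}
    (hG : IsProperDomain G) {b : E} {D : ℝ} (hD : 0 ≤ D)
    (hfr : frontier G ⊆ Metric.closedBall b D) :
    G ⊆ Metric.closedBall b D ∨ (Metric.closedBall b D)ᶜ ⊆ G := by
  by_contra hcon
  push Not at hcon
  obtain ⟨h1, h2⟩ := hcon
  obtain ⟨p, hpG, hp⟩ := Set.not_subset.1 h1
  obtain ⟨q, hq, hqG⟩ := Set.not_subset.1 h2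
  simp only [Metric.mem_closedBall, not_le, Set.mem_compl_iff] at hp hq
  have hsphere : Metric.sphere b (dist p b) ⊆ G := by
    refine subset_of_disjoint_frontier hG.1 (isConnected_sphere hE b dist_nonneg).isPreconnected
      (fun x hx hxf => ?_) (p := p) rfl hpG
    have := Metric.mem_closedBall.1 (hfr hxf)
    rw [Metric.mem_sphere.1 hx] at this
    linarith
  have hq0 : 0 < dist q b := hD.trans_lt hq
  -- the ray from `b` through `q`, outside the ball, joins `q` to the sphere through `p`
  have hnorm : ∀ s : ℝ, 0 ≤ s → dist (b + s • (q - b)) b = s * dist q b := by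
    intro s hs
    rw [dist_eq_norm, add_sub_cancel_left, norm_smul, Real.norm_eq_abs, abs_of_nonneg hs,
      dist_eq_norm]
  have hray : (fun s : ℝ => b + s • (q - b)) '' Set.Ioi (D / dist q b) ⊆ G := by
    refine subset_of_disjoint_frontier hG.1
      (isPreconnected_Ioi.image _ (by fun_prop)) ?_ (p := b + (dist p b / dist q b) • (q - b))
      ⟨_, ?_, rfl⟩ (hsphere ?_)
    · rintro _ ⟨s, hs, rfl⟩ hsf
      have h3 := Metric.mem_closedBall.1 (hfr hsf)
      have hs' : D / dist q b < s := hs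
      rw [div_lt_iff₀ hq0] at hs'
      simp only [hnorm s ((div_nonneg hD hq0.le).trans hs.le)] at h3
      linarith
    · exact div_lt_div_of_pos_right hp hq0
    · rw [Metric.mem_sphere, hnorm _ (by positivity), div_mul_cancel₀ _ hq0.ne']
  exact hqG (by simpa using hray ⟨1, by rwa [Set.mem_Ioi, div_lt_one hq0], rfl⟩)

lemma le_bdist_of_far {G : Set E} (hG : IsProperDomain G) {b : E} {D : ℝ}
    (hfr : frontier G ⊆ Metric.closedBall b D) {p : E} (hp : 3 * D ≤ dist p b) :
    2 * dist p b ≤ 3 * bdist G p := by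
  have : dist p b - D ≤ bdist G p := by
    refine (Metric.le_infDist hG.frontier_nonempty).2 fun y hy => ?_
    have h1 := Metric.mem_closedBall.1 (hfr hy)
    linarith [dist_triangle p y b]
  linarith

lemma exists_path_monotone_dist (hE : 1 < Module.rank ℝ E) {b u v : E} (hu : 0 < dist u b)
    (huv : dist u b ≤ dist v b) : ∃ γ : Path u v, Monotone fun t => dist (γ t) b := by
  have hv : 0 < dist v b := hu.trans_le huv
  set r := dist u b with hr
  set R := dist v b with hR
  have hw : b + (r / R) • (v - b) ∈ Metric.sphere b r := by
    rw [Metric.mem_sphere, dist_eq_norm, add_sub_cancel_left, norm_smul, ← dist_eq_norm, ← hR,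
      Real.norm_eq_abs, abs_of_nonneg (by positivity), div_mul_cancel₀ _ hv.ne']
  obtain ⟨σ, hσ⟩ := (isPathConnected_sphere hE b hu.le).joinedIn u rfl _ hw
  refine ⟨⟨⟨fun t => b + (1 + t * (R / r - 1)) • (σ t - b), by fun_prop⟩, by simp, ?_⟩, ?_⟩
  · simp only [Set.Icc.coe_one, one_mul, add_sub_cancel, σ.target, add_sub_cancel_left, smul_smul]
    rw [div_mul_div_cancel₀ hu.ne', div_self hv.ne', one_smul, add_sub_cancel]
  · have hRr : 0 ≤ R / r - 1 := sub_nonneg.2 ((one_le_div hu).2 huv)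
    have hnorm : ∀ t : unitInterval, dist (b + (1 + (t : ℝ) * (R / r - 1)) • (σ t - b)) b =
        (1 + t * (R / r - 1)) * r := by
      intro t
      have h1 : ‖σ t - b‖ = r := by rw [← dist_eq_norm]; exact hσ t
      have h2 := mul_nonneg t.2.1 hRr
      rw [dist_eq_norm, add_sub_cancel_left, norm_smul, h1, Real.norm_eq_abs,
        abs_of_nonneg (by linarith)]
    intro s t hst
    have hst' : (s : ℝ) ≤ t := hst
    show dist (b + (1 + (s : ℝ) * (R / r - 1)) • (σ s - b)) b ≤
      dist (b + (1 + (t : ℝ) * (R / r - 1)) • (σ t - b)) b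
    rw [hnorm, hnorm]
    gcongr

variable {G : Set E} {b : E} {D : ℝ}

lemma DiamJoined.of_far (hE : 1 < Module.rank ℝ E) (hG : IsProperDomain G)
    (hfr : frontier G ⊆ Metric.closedBall b D) (hext : (Metric.closedBall b D)ᶜ ⊆ G)
    {u v : E} (hu : 3 * D ≤ dist u b) (hub : 0 < dist u b)
    (huv : dist u b ≤ dist v b) (hsep : bdist G v / 2 ≤ dist u v) :
    DiamJoined 12 G u v := by
  obtain ⟨γ, hγ⟩ := exists_path_monotone_dist hE hub huv
  have h0 : ∀ t, dist u b ≤ dist (γ t) b := fun t => by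
    simpa using hγ (show (0 : unitInterval) ≤ t from t.2.1)
  have h1 : ∀ t, dist (γ t) b ≤ dist v b := fun t => by
    simpa using hγ (show t ≤ (1 : unitInterval) from t.2.2)
  have hfar := fun t => le_bdist_of_far hG hfr (hu.trans (h0 t))
  have hv := le_bdist_of_far hG hfr (hu.trans huv)
  have := DiamJoined.of_dist_le (G := G) (C := 6) (by norm_num) γ (fun t => hext ?_) (fun t => ?_)
    fun t => Or.inl fun s hs => ?_
  · convert this using 1; norm_num
  · rw [Set.mem_compl_iff, Metric.mem_closedBall, not_le]
    linarith [h0 t]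
  · linarith [dist_triangle_right (γ t) u b, h1 t]
  · have : dist (γ s) b ≤ dist (γ t) b := hγ hs
    linarith [dist_triangle_right (γ s) (γ t) b, hfar t, bdist_nonneg G (γ t)]

/-- If a point `u` is far from the boundary, then it suffices to join its radial retraction `w` to
`v`, as the segment from `u` to `w` may be prepended to a cigar. -/
lemma DiamJoined.of_radialRetraction {A : ℝ} (hA : 1 ≤ A) (hG : IsProperDomain G)
    (hfr : frontier G ⊆ Metric.closedBall b D) (hext : (Metric.closedBall b D)ᶜ ⊆ G)
    (hD : 0 < D) {u v : E} (hu : 3 * D ≤ dist u b) (hv : dist v b ≤ 3 * D)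
    (h : DiamJoined A G (radialRetraction b (3 * D) u) v) : DiamJoined (20 * A ^ 2) G u v := by
  have hR : 0 < 3 * D := by positivity
  set w := radialRetraction b (3 * D) u with hw
  have hwb : dist w b = 3 * D := dist_radialRetraction_of_ge hR hu
  have huw : dist u w = dist u b - 3 * D := dist_radialRetraction_self hR hu
  obtain ⟨δ, hδ, hcig, hturn⟩ := h
  have hA2 : A ≤ A ^ 2 := by nlinarith
  have hδr : ∀ s t, dist (δ s) (δ t) ≤ A * dist w v := fun s t =>
    (Metric.dist_le_diam_of_mem (isCompact_range δ.continuous).isBounded ⟨s, rfl⟩ ⟨t, rfl⟩).trans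
      hturn
  have hwv : dist w v ≤ 6 * D := by linarith [dist_triangle_right w v b]
  have hδD : ∀ s t, dist (δ s) (δ t) ≤ A * (6 * D) := fun s t =>
    (hδr s t).trans (by gcongr)
  have hδb : ∀ s, dist (δ s) b ≤ A * (6 * D) + 3 * D := fun s => by
    have := hδD s 0
    rw [δ.source] at this
    linarith [dist_triangle (δ s) w b]
  have hwd := le_bdist_of_far hG hfr hwb.ge
  set σ : Path u w := Path.segment u w with hσ
  have hub : 0 < dist u b := hR.trans_le hu
  have hσb : ∀ t, dist (σ t) b = (1 - t) * dist u b + t * (3 * D) := by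
    intro t
    have h1 := t.2.1
    have h2 : 0 ≤ 1 - (t : ℝ) := sub_nonneg.2 t.2.2
    have e : σ t - b = ((1 - (t : ℝ)) + t * (3 * D / dist u b)) • (u - b) := by
      rw [hσ, Path.segment_apply, AffineMap.lineMap_apply_module, hw, radialRetraction,
        ← dist_eq_norm, max_eq_right hu]
      module
    rw [dist_eq_norm, e, norm_smul, ← dist_eq_norm, Real.norm_eq_abs,
      abs_of_nonneg (by positivity), add_mul, mul_assoc, div_mul_cancel₀ _ hub.ne']
  have hσu : ∀ t, dist (σ t) u ≤ dist u w := by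
    intro t
    rw [hσ, Path.segment_apply, dist_lineMap_left, Real.norm_eq_abs, abs_of_nonneg t.2.1]
    exact mul_le_of_le_one_left dist_nonneg t.2.2
  have hσfar : ∀ t, 3 * D ≤ dist (σ t) b := by
    intro t
    rw [hσb]
    nlinarith [t.2.1, t.2.2]
  have huv : dist u w ≤ dist u v := by linarith [dist_triangle u v b]
  have hwv' : dist w v ≤ 2 * dist u v := by linarith [dist_triangle_left w v u]
  have hAD : D ≤ A * D := le_mul_of_one_le_left hD.le hA
  have hA0 : 0 ≤ A := by linarith
  have hbd : ∀ z, A * bdist G z ≤ A ^ 2 * bdist G z := fun z =>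
    mul_le_mul_of_nonneg_right hA2 (bdist_nonneg _ _)
  have hδtail : ∀ s t, t ≤ s → dist (δ s) (δ t) ≤ 10 * A ^ 2 * bdist G (δ t) := by
    intro s t hst
    have hb := mul_nonneg (sq_nonneg A) (bdist_nonneg G (δ t))
    rcases min_le_iff.1 (hcig t) with h | h
    · -- otherwise `δ t` is far from the boundary, because `w` is
      have h1 : dist w (δ t) ≤ A * bdist G (δ t) := (Metric.dist_le_diam_of_mem
        (isBounded_image_path δ _) ⟨0, (t.2.1 : (0 : unitInterval) ≤ t), δ.source⟩
        ⟨t, (le_refl t : t ≤ t), rfl⟩).trans h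
      have h2 := bdist_le_add G w (δ t)
      have h3 : 2 * D ≤ bdist G (δ t) + A * bdist G (δ t) := by linarith
      have h4 : A * (2 * D) ≤ A * (bdist G (δ t) + A * bdist G (δ t)) := by gcongr
      linarith [hδD s t, hbd (δ t)]
    · have h1 : dist (δ s) (δ t) ≤ A * bdist G (δ t) := (Metric.dist_le_diam_of_mem
        (isBounded_image_path δ _) ⟨s, hst, rfl⟩ ⟨t, (le_refl t : t ≤ t), rfl⟩).trans h
      linarith [hbd (δ t)]
  have hσtail : ∀ z t, dist z b ≤ (2 * A + 1) * dist (σ t) b →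
      dist z (σ t) ≤ 10 * A ^ 2 * bdist G (σ t) := by
    intro z t hz
    have h1 := le_bdist_of_far hG hfr (hσfar t)
    have h2 : A * (2 * dist (σ t) b) ≤ A * (3 * bdist G (σ t)) := by gcongr
    have h3 : dist (σ t) b ≤ A * dist (σ t) b := le_mul_of_one_le_left dist_nonneg hA
    have hb := mul_nonneg (sq_nonneg A) (bdist_nonneg G (σ t))
    linarith [dist_triangle_right z (σ t) b, hbd (σ t)]
  have hδu : ∀ t, dist (δ t) u ≤ 10 * A ^ 2 * dist u v := by
    intro t
    have h0 : A * dist u v ≤ A ^ 2 * dist u v := by gcongr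
    have h1 : dist u v ≤ A * dist u v := le_mul_of_one_le_left dist_nonneg hA
    have h2 := hδr t 0
    rw [δ.source] at h2
    have h3 : A * dist w v ≤ A * (2 * dist u v) := by gcongr
    linarith [dist_triangle_right (δ t) u w]
  have key := DiamJoined.of_dist_le (G := G) (C := 10 * A ^ 2) (by positivity) (σ.trans δ)
    (fun t => ?_) (fun t => ?_) fun t => Or.inr fun s hs => ?_
  · rwa [show 2 * (10 * A ^ 2) = 20 * A ^ 2 by ring] at key
  · rw [Path.trans_apply]
    split_ifs with ht
    · refine hext ?_
      rw [Set.mem_compl_iff, Metric.mem_closedBall, not_le]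
      linarith [hσfar ⟨2 * t, (unitInterval.mul_pos_mem_iff zero_lt_two).2 ⟨t.2.1, ht⟩⟩]
    · exact hδ _
  · rw [Path.trans_apply]
    split_ifs with ht
    · refine (hσu _).trans (huv.trans (le_mul_of_one_le_left dist_nonneg ?_))
      nlinarith
    · exact hδu _
  · have hst : (t : ℝ) ≤ s := hs
    rw [Path.trans_apply, Path.trans_apply]
    split_ifs with hs' ht' ht'
    · refine hσtail _ _ ?_
      have h1 : dist (σ ⟨2 * s, (unitInterval.mul_pos_mem_iff zero_lt_two).2 ⟨s.2.1, hs'⟩⟩) b ≤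
          dist (σ ⟨2 * t, (unitInterval.mul_pos_mem_iff zero_lt_two).2 ⟨t.2.1, ht'⟩⟩) b := by
        rw [hσb, hσb]
        nlinarith [mul_nonneg (sub_nonneg.2 hst) (sub_nonneg.2 hu)]
      exact h1.trans (le_mul_of_one_le_left dist_nonneg (by linarith))
    · exact absurd (hst.trans hs') ht'
    · refine hσtail _ _ ((hδb _).trans ?_)
      calc A * (6 * D) + 3 * D = (2 * A + 1) * (3 * D) := by ring
        _ ≤ _ := by gcongr; exact hσfar _
    · exact hδtail _ _ (show 2 * (t : ℝ) - 1 ≤ 2 * s - 1 by linarith)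

end Exterior

/-! ### The image domain is uniform -/

section Main

variable {E : Type u} [NormedAddCommGroup E]
  {E' : Type v} [NormedAddCommGroup E'] [NormedSpace ℝ E']

lemma exists_frontier_far_of_diam {G : Set E} (hfr : 0 < Metric.diam (frontier G)) (x : E) :
    ∃ c ∈ frontier G, Metric.diam (frontier G) / 3 ≤ dist c x := by
  by_contra hcon
  push Not at hcon
  have : Metric.diam (frontier G) ≤ 2 * Metric.diam (frontier G) / 3 := by
    refine Metric.diam_le_of_forall_dist_le (by positivity) fun p hp q hq => ?_
    linarith [hcon p hp, hcon q hq, dist_triangle_right p q x]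
  linarith

lemma exists_frontier_far_of_not_isBounded {G : Set E} (hfr : ¬ Bornology.IsBounded (frontier G))
    (x : E) (r : ℝ) : ∃ c ∈ frontier G, r ≤ dist c x := by
  by_contra hcon
  push Not at hcon
  exact hfr (Metric.isBounded_closedBall.subset fun c hc => Metric.mem_closedBall.2 (hcon c hc).le)

/-- In the case of a bounded boundary the points of the image domain not too far from the boundary
are joined by the radial retraction of the image of a cigar. -/
lemma DiamJoined.image_of_near {A : ℝ} (hA : 1 ≤ A) {θ : ℝ≥0 ≃ₜ ℝ≥0} {Θ : ℝ≥0} (h1Θ : 1 ≤ Θ)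
    (hΘ : ∀ t ≤ (100 * A ^ 3).toNNReal, θ t ≤ Θ) {G : Set E} {G' : Set E'} (hG : IsProperDomain G)
    (hG' : IsProperDomain G') (hE' : 1 < Module.rank ℝ E') (hU : IsDiameterUniform A G)
    {f : closure G ≃ₜ closure G'} (hfG : ∀ x, (f x : E') ∈ G' ↔ (x : E) ∈ G)
    (hf : IsQuasimobiusRel θ {x : closure G | (x : E) ∈ frontier G} f) {b : E'} {D : ℝ}
    (hD : Metric.diam (frontier G') = D) (hD0 : 0 < D)
    (hfr : frontier G' ⊆ Metric.closedBall b D) {y₁ y₂ : E'} (hy₁ : y₁ ∈ G') (hy₂ : y₂ ∈ G')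
    (hb₁ : dist y₁ b ≤ 3 * D) (hb₂ : dist y₂ b ≤ 3 * D) : DiamJoined (7200 * Θ) G' y₁ y₂ := by
  have h1Θ' : (1 : ℝ) ≤ Θ := by exact_mod_cast h1Θ
  rcases le_total (dist y₁ y₂) (max (bdist G' y₁) (bdist G' y₂) / 2) with hclose | hsep
  · exact (LengthJoined.of_dist_le (by linarith) hG' hy₁ hy₂ hclose).diamJoined (by linarith)
  have hR : 0 < 3 * D := by positivity
  have hball := dist_radialRetraction_le (b := b) hR
  have hdiam : ∀ p q : E', dist p b ≤ 3 * D → dist q b ≤ 3 * D → dist p q ≤ 6 * D :=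
    fun p q hp hq => by linarith [dist_triangle_right p q b]
  have hfar : ∀ v, 3 * D ≤ dist v b →
      2 * (3 * D) ≤ 3 * bdist G' (radialRetraction b (3 * D) v) := fun v hv => by
    have h := dist_radialRetraction_of_ge hR hv
    have := le_bdist_of_far hG' hfr h.ge
    rwa [h] at this
  have hconst : 2 * (3600 * (Θ : ℝ)) = 7200 * Θ := by ring
  rw [← hconst]
  refine DiamJoined.image hA h1Θ hΘ hG hG' hU hfG hf (k := 100 * Θ) (le_refl _) (by linarith)
    (φ := radialRetraction b (3 * D)) (B := Metric.closedBall b (3 * D))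
    (continuous_radialRetraction hR) (fun u hu => radialRetraction_of_le hR hu)
    (fun u hu v => dist_radialRetraction_le_two_mul hR hu) (fun v hv => ?_) hy₁ hy₂ hb₁ hb₂ hsep
    ?_ (fun u hu => ?_)
  · rcases le_total (dist v b) (3 * D) with h | h
    · rwa [radialRetraction_of_le hR h]
    · rcases hG'.subset_closedBall_or hE' hD0.le hfr with hc | hc
      · have := Metric.mem_closedBall.1 (hc hv)
        linarith
      · refine hc ?_
        rw [Set.mem_compl_iff, Metric.mem_closedBall, dist_radialRetraction_of_ge hR h]
        linarith
  · obtain ⟨c, hc, hcy⟩ := exists_frontier_far_of_diam (hD ▸ hD0) y₁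
    rw [hD] at hcy
    rcases le_total (2 * (100 * Θ) * dist y₁ y₂) (D / 3) with h | h
    · exact Or.inl ⟨c, hc, h.trans hcy⟩
    · exact Or.inr fun v _ => (hdiam _ _ (hball v) hb₁).trans (by linarith)
  · rcases le_total (dist u b) (3 * D) with hu' | hu'
    · obtain ⟨c, hc, hcy⟩ := exists_frontier_far_of_diam (hD ▸ hD0) u
      rw [hD] at hcy
      rcases le_total (2 * (100 * Θ) * bdist G' u) (D / 3) with h | h
      · exact Or.inl ⟨hu', c, hc, h.trans hcy⟩
      · refine Or.inr fun v _ => (hdiam _ _ (hball v) (hball u)).trans ?_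
        rw [radialRetraction_of_le hR hu']
        linarith
    · refine Or.inr fun v _ => (hdiam _ _ (hball v) (hball u)).trans ?_
      have h1 := hfar u hu'
      have h2 : 3600 * 1 * bdist G' (radialRetraction b (3 * D) u) ≤
          3600 * Θ * bdist G' (radialRetraction b (3 * D) u) := by
        have := bdist_nonneg G' (radialRetraction b (3 * D) u)
        gcongr
      linarith

/-- Diameter uniformity is preserved by homeomorphisms that are quasimöbius relative to the
boundary. -/
lemma DiamJoined.of_isQuasimobiusRel {A : ℝ} (hA : 1 ≤ A) {θ : ℝ≥0 ≃ₜ ℝ≥0} {Θ : ℝ≥0}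
    (h1Θ : 1 ≤ Θ) (hΘ : ∀ t ≤ (100 * A ^ 3).toNNReal, θ t ≤ Θ) {G : Set E} {G' : Set E'}
    (hG : IsProperDomain G) (hG' : IsProperDomain G') (hE' : 1 < Module.rank ℝ E')
    (hU : IsDiameterUniform A G) {f : closure G ≃ₜ closure G'}
    (hfG : ∀ x, (f x : E') ∈ G' ↔ (x : E) ∈ G)
    (hf : IsQuasimobiusRel θ {x : closure G | (x : E) ∈ frontier G} f) {y₁ y₂ : E'}
    (hy₁ : y₁ ∈ G') (hy₂ : y₂ ∈ G') : DiamJoined (20 * (7200 * Θ) ^ 2) G' y₁ y₂ := by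
  have h1Θ' : (1 : ℝ) ≤ Θ := by exact_mod_cast h1Θ
  have hle : 7200 * (Θ : ℝ) ≤ 20 * (7200 * Θ) ^ 2 := by nlinarith
  rcases le_total (dist y₁ y₂) (max (bdist G' y₁) (bdist G' y₂) / 2) with hclose | hsep
  · exact (LengthJoined.of_dist_le (by linarith) hG' hy₁ hy₂ hclose).diamJoined (by linarith)
  by_cases hbdd : Bornology.IsBounded (frontier G')
  · obtain ⟨b, hb⟩ := hG'.frontier_nonempty
    set D := Metric.diam (frontier G') with hD
    have hD0 : 0 ≤ D := Metric.diam_nonneg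
    have hfr : frontier G' ⊆ Metric.closedBall b D := fun c hc =>
      Metric.mem_closedBall.2 (Metric.dist_le_diam_of_mem hbdd hc hb)
    have hpos : ∀ y ∈ G', 0 < dist y b := fun y hy =>
      dist_pos.2 fun e => (hG'.1.frontier_eq ▸ hb : b ∈ closure G' \ G').2 (e ▸ hy)
    have hext : ∀ y ∈ G', 0 < dist y b - D → (Metric.closedBall b D)ᶜ ⊆ G' := by
      intro y hy h3
      refine (hG'.subset_closedBall_or hE' hD0 hfr).resolve_left fun h => ?_
      have := Metric.mem_closedBall.1 (h hy)
      linarith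
    have hnf : ∀ u ∈ G', ∀ v ∈ G', 3 * D < dist u b → dist v b ≤ 3 * D →
        DiamJoined (20 * (7200 * Θ) ^ 2) G' u v := by
      intro u hu v hv hub hvb
      have hDp : 0 < D := by linarith [hpos v hv]
      have hex := hext u hu (by linarith)
      have hw := dist_radialRetraction_of_ge (by positivity) hub.le
      refine DiamJoined.of_radialRetraction (by linarith) hG' hfr hex hDp hub.le hvb
        (DiamJoined.image_of_near hA h1Θ hΘ hG hG' hE' hU hfG hf hD.symm hDp hfr (hex ?_) hv
          hw.le hvb)
      rw [Set.mem_compl_iff, Metric.mem_closedBall, hw]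
      linarith
    have hff : ∀ u ∈ G', ∀ v ∈ G', 3 * D < dist u b → dist u b ≤ dist v b →
        bdist G' v / 2 ≤ dist u v → DiamJoined (20 * (7200 * Θ) ^ 2) G' u v := by
      intro u hu v _ hub huv h
      exact (DiamJoined.of_far hE' hG' hfr (hext u hu (by linarith)) hub.le (hpos u hu)
        huv h).mono (by linarith)
    rcases le_or_gt (dist y₁ b) (3 * D) with h₁ | h₁ <;>
      rcases le_or_gt (dist y₂ b) (3 * D) with h₂ | h₂
    · exact (DiamJoined.image_of_near hA h1Θ hΘ hG hG' hE' hU hfG hf hD.symm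
        (by linarith [hpos y₁ hy₁]) hfr hy₁ hy₂ h₁ h₂).mono hle
    · exact (hnf _ hy₂ _ hy₁ h₂ h₁).symm
    · exact hnf _ hy₁ _ hy₂ h₁ h₂
    · rcases le_total (dist y₁ b) (dist y₂ b) with h | h
      · exact hff _ hy₁ _ hy₂ h₁ h (by linarith [le_max_right (bdist G' y₁) (bdist G' y₂)])
      · refine (hff _ hy₂ _ hy₁ h₂ h ?_).symm
        rw [dist_comm]
        linarith [le_max_left (bdist G' y₁) (bdist G' y₂)]
  · have hfar := exists_frontier_far_of_not_isBounded hbdd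
    exact (DiamJoined.image hA h1Θ hΘ hG hG' hU hfG hf (k := 100 * Θ) (C := 200 * Θ) (le_refl _)
      (by linarith) (φ := id) (B := Set.univ) continuous_id (fun _ _ => rfl)
      (fun u _ v => by rw [id]; linarith [dist_nonneg (x := v) (y := u)]) (fun _ h => h) hy₁ hy₂
      (Set.mem_univ _) (Set.mem_univ _) hsep (Or.inl (hfar _ _))
      fun u _ => Or.inl ⟨Set.mem_univ _, hfar _ _⟩).mono (by linarith)

end Main

end RelQM

theorem corollary1p4 (A : ℝ) (θ : ℝ≥0 ≃ₜ ℝ≥0) (ψ : ℝ≥0 → ℝ≥0) :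
    ∃ A₁ : ℝ,
      ∀ (E : Type u) [NormedAddCommGroup E] [NormedSpace ℝ E] [CompleteSpace E]
        (E' : Type v) [NormedAddCommGroup E'] [NormedSpace ℝ E'] [CompleteSpace E'],
        2 ≤ Module.rank ℝ E → 2 ≤ Module.rank ℝ E' →
        ∀ (G : Set E) (G' : Set E'),
          RelQM.IsProperDomain G → RelQM.IsProperDomain G' →
          RelQM.IsDiameterUniform A G → RelQM.IsNatural ψ G' →
          ∀ f : closure G ≃ₜ closure G',
            (∀ x, (f x : E') ∈ G' ↔ (x : E) ∈ G) →
            RelQM.IsQuasimobiusRel θ {x : closure G | (x : E) ∈ frontier G} f →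
            RelQM.IsUniform A₁ G' := by
  obtain ⟨Θ₀, hΘ₀⟩ :=
    ((isCompact_Icc (a := 0) (b := (100 * A ^ 3).toNNReal)).image θ.continuous).bddAbove
  set Θ := max 1 Θ₀
  have h1Θ : 1 ≤ Θ := le_max_left _ _
  have h1Θ' : (1 : ℝ) ≤ Θ := by exact_mod_cast h1Θ
  have hΘ : ∀ t ≤ (100 * A ^ 3).toNNReal, θ t ≤ Θ := fun t ht =>
    (hΘ₀ ⟨t, ⟨zero_le, ht⟩, rfl⟩).trans (le_max_right _ _)
  set A₂ : ℝ := 20 * (7200 * Θ) ^ 2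
  have hA₂ : 1 ≤ A₂ := by nlinarith
  have hB := one_le_pow₀ (RelQM.one_le_naturalBound A₂ ψ) (n := 2)
  have hA₁ : 1 ≤ 16 * A₂ * RelQM.naturalBound A₂ ψ ^ 2 := by nlinarith
  refine ⟨16 * A₂ * RelQM.naturalBound A₂ ψ ^ 2, fun E _ _ _ E' _ _ _ _ hE' G G' hG hG' hU hψ f
    hfG hf => ⟨hA₁, fun y₁ hy₁ y₂ hy₂ => ?_⟩⟩
  change RelQM.LengthJoined _ G' y₁ y₂
  have hE'1 : 1 < Module.rank ℝ E' := lt_of_lt_of_le (by norm_num) hE'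
  rcases le_total (dist y₁ y₂) (max (RelQM.bdist G' y₁) (RelQM.bdist G' y₂) / 2) with h | h
  · exact RelQM.LengthJoined.of_dist_le hA₁ hG' hy₁ hy₂ h
  · exact (RelQM.DiamJoined.of_isQuasimobiusRel hU.1 h1Θ hΘ hG hG' hE'1 hU hfG hf hy₁
      hy₂).lengthJoined hA₂ hψ (fun z hz => hG'.bdist_pos hz) h
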